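/- Let $G$ be a finite group. A subgroup $H$ of $G$ is called an $IC\Phi$-subgroup of $G$ if $H \cap [H,G] \le \Phi(H)$, where $\Phi(H)$ denotes the Frattini subgroup of $H$; and $H$ is called $3$-maximal in $G$ if there is a chain of subgroups $H = H_0 < H_1 < H_2 < H_3 = G$ such that $H_i$ is a maximal subgroup of $H_{i+1}$ for $i = 0,1,2$. Suppose that $G$ has a non-trivial $3$-maximal subgroup and that every $3$-maximal subgroup of $G$ is an $IC\Phi$-subgroup of $G$. Then either $G$ is nilpotent or $G \cong SL_2(3)$, the group of $2 \times 2$ matrices of determinant $1$ over the field with three elements. -/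

import Mathlib

/-- `H` is an `ICΦ`-subgroup of `G`: `H ∩ [H, G] ≤ Φ(H)`, where the Frattini subgroup `Φ(H)`
of the group `H` is regarded as a subgroup of `G`. -/
def IsICPhi {G : Type*} [Group G] (H : Subgroup G) : Prop :=
  H ⊓ ⁅H, (⊤ : Subgroup G)⁆ ≤ (frattini H).map H.subtype

/-- `H` is `n`-maximal in `G`: there is a chain `H = H₀ < H₁ < ⋯ < Hₙ = G` of subgroups of `G` in
which each `Hᵢ` is a maximal subgroup of `Hᵢ₊₁`. (`K ⋖ L` says that `K < L` with no subgroup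
strictly in between.) -/
def IsNMaximal {G : Type*} [Group G] (n : ℕ) (H : Subgroup G) : Prop :=
  ∃ c : Fin (n + 1) → Subgroup G,
    c 0 = H ∧ c (Fin.last n) = ⊤ ∧ ∀ i : Fin n, c i.castSucc ⋖ c i.succ

/-! The driving fact is that an ICΦ-subgroup `H` with `H ≤ [H, G]` satisfies `H ≤ Φ(H)`, hence is
trivial. From it, a group whose maximal subgroups are all ICΦ is nilpotent. Since ICΦ passes to
intermediate groups, every 2-maximal subgroup of `G` is nilpotent.

A non-nilpotent maximal subgroup would have order `pq` (`card_eq_mul_of_isNMaximal_two`). This is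
incompatible with a non-trivial 3-maximal subgroup, which gives `|G|` at least four prime factors.
So a non-nilpotent `G` has only nilpotent maximal subgroups, and Schmidt's structure applies: `G =
PQ` with `P` a normal Sylow subgroup, `P = [P, G]`, and every smaller normal subgroup of `G` inside
`P` central.

An ICΦ-subgroup never contains `P`, and an ICΦ-subgroup inside `P` is central. Hence a maximal chain
from `G` reaches `P` in at most two steps. Two steps would force `|P| = p` and only three prime
factors in `|G|`. If `P` is maximal, its second maximal subgroups are central, so each non-central
element generates a maximal subgroup of `P`. For odd `p` the class two power formula then yields
`|P| = p²`, which is too small. For `p = 2` conjugation by an element outside `P` gives the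
relations of `Q₈ ⋊ C₃ ≅ SL₂(3)`. -/

open Subgroup
open scoped commutatorElement

/-! ### Chains of maximal subgroups. -/

section NMaximal

variable {G G' : Type*} [Group G] [Group G']

theorem isNMaximal_zero {H : Subgroup G} : IsNMaximal 0 H ↔ H = ⊤ := by
  constructor
  · rintro ⟨c, h0, h1, -⟩
    exact h0.symm.trans h1
  · rintro rfl
    exact ⟨fun _ => ⊤, rfl, rfl, fun i => i.elim0⟩

theorem isNMaximal_succ {n : ℕ} {H : Subgroup G} :
    IsNMaximal (n + 1) H ↔ ∃ K, H ⋖ K ∧ IsNMaximal n K := by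
  constructor
  · rintro ⟨c, h0, h1, h⟩
    refine ⟨c 1, ?_, fun i => c i.succ, rfl, ?_, fun i => ?_⟩
    · have := h 0
      rwa [Fin.castSucc_zero, h0] at this
    · simpa using h1
    · simpa using h i.succ
  · rintro ⟨K, hK, c, h0, h1, h⟩
    refine ⟨Fin.cons H c, rfl, ?_, fun i => ?_⟩
    · rw [← Fin.succ_last]
      simpa using h1
    · refine Fin.cases ?_ (fun j => ?_) i
      · simpa [h0] using hK
      · simpa using h j

theorem isNMaximal_one {H : Subgroup G} : IsNMaximal 1 H ↔ H ⋖ ⊤ := by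
  simp [isNMaximal_succ, isNMaximal_zero]

theorem Subgroup.CovBy.map_of_injective {f : G →* G'} (hf : Function.Injective f)
    {K H : Subgroup G} (h : K ⋖ H) : K.map f ⋖ H.map f := by
  refine ⟨(map_lt_map_iff_of_injective hf).2 h.1, fun A h1 h2 => ?_⟩
  have hA : (A.comap f).map f = A := by
    rw [map_comap_eq, inf_eq_right]
    exact h2.le.trans (map_le_range f H)
  rw [← hA] at h1 h2
  exact h.2 ((map_lt_map_iff_of_injective hf).1 h1) ((map_lt_map_iff_of_injective hf).1 h2)

theorem Subgroup.CovBy.comap_of_surjective {f : G →* G'} (hf : Function.Surjective f)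
    {K H : Subgroup G'} (h : K ⋖ H) : K.comap f ⋖ H.comap f := by
  refine ⟨(comap_lt_comap_of_surjective hf).2 h.1, fun A h1 h2 => ?_⟩
  have hA : (A.map f).comap f = A := by
    rw [comap_map_eq, sup_eq_left]
    refine le_trans ?_ h1.le
    exact f.ker_le_comap K
  rw [← hA] at h1 h2
  exact h.2 ((comap_lt_comap_of_surjective hf).1 h1) ((comap_lt_comap_of_surjective hf).1 h2)

theorem IsNMaximal.comap_of_surjective {f : G →* G'} (hf : Function.Surjective f) {n : ℕ}
    {H : Subgroup G'} (h : IsNMaximal n H) : IsNMaximal n (H.comap f) := by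
  induction n generalizing H with
  | zero => rw [isNMaximal_zero] at h ⊢; simp [h]
  | succ n ih =>
    rw [isNMaximal_succ] at h ⊢
    obtain ⟨K, hK, h⟩ := h
    exact ⟨_, CovBy.comap_of_surjective hf hK, ih h⟩

theorem IsNMaximal.map_of_surjective {f : G →* G'} (hf : Function.Surjective f) {n : ℕ}
    {H : Subgroup G} (hker : f.ker ≤ H) (h : IsNMaximal n H) : IsNMaximal n (H.map f) := by
  induction n generalizing H with
  | zero =>
    rw [isNMaximal_zero] at h ⊢
    rw [h, map_top_of_surjective f hf]
  | succ n ih =>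
    rw [isNMaximal_succ] at h ⊢
    obtain ⟨K, hK, h⟩ := h
    have e : ∀ A : Subgroup G, f.ker ≤ A → (A.map f).comap f = A := fun A hA => by
      rw [comap_map_eq, sup_eq_left.2 hA]
    have hKker := hker.trans hK.le
    refine ⟨_, ⟨?_, fun A h1 h2 => ?_⟩, ih hKker h⟩
    · rw [← comap_lt_comap_of_surjective hf, e H hker, e K hKker]
      exact hK.1
    · rw [← comap_lt_comap_of_surjective hf] at h1 h2
      rw [e H hker] at h1
      rw [e K hKker] at h2
      exact hK.2 h1 h2

theorem IsNMaximal.map_subtype {M : Subgroup G} {m n : ℕ} (hM : IsNMaximal m M)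
    {H : Subgroup M} (h : IsNMaximal n H) : IsNMaximal (m + n) (H.map M.subtype) := by
  induction n generalizing H with
  | zero =>
    rw [isNMaximal_zero] at h
    subst h
    rwa [← MonoidHom.range_eq_map, range_subtype]
  | succ n ih =>
    rw [← add_assoc]
    rw [isNMaximal_succ] at h ⊢
    obtain ⟨K, hK, h⟩ := h
    exact ⟨_, CovBy.map_of_injective M.subtype_injective hK, ih h⟩

/-- Descending maximal chains from `G` either end at `P` early or reach level `n` above `P`. -/
theorem exists_isNMaximal_ge [Finite G] (n : ℕ) (P : Subgroup G) :
    (∃ k < n, IsNMaximal k P) ∨ ∃ S, P ≤ S ∧ IsNMaximal n S := by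
  induction n with
  | zero => exact Or.inr ⟨⊤, le_top, isNMaximal_zero.2 rfl⟩
  | succ n ih =>
    rcases ih with ⟨k, hk, h⟩ | ⟨S, hS, h⟩
    · exact Or.inl ⟨k, hk.trans n.lt_succ_self, h⟩
    · rcases hS.eq_or_lt with rfl | hlt
      · exact Or.inl ⟨n, n.lt_succ_self, h⟩
      · obtain ⟨K, h1, h2⟩ := exists_le_covBy_of_lt hlt
        exact Or.inr ⟨K, h1, isNMaximal_succ.2 ⟨S, h2, h⟩⟩

end NMaximal

/-! ### Frattini subgroups and the ICΦ condition. -/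

section Frattini

variable {G G' : Type*} [Group G] [Group G']

theorem covBy_iff_isCoatom_subgroupOf {K H : Subgroup G} (hK : K ≤ H) :
    K ⋖ H ↔ IsCoatom (K.subgroupOf H) := by
  have e : ∀ A ≤ H, (A.subgroupOf H).map H.subtype = A := fun A hA => by simpa using hA
  rw [← covBy_top_iff]
  constructor
  · intro h
    refine ⟨lt_top_iff_ne_top.2 fun h' => h.1.not_ge (subgroupOf_eq_top.1 h'), fun A h1 h3 => ?_⟩
    have h2 := (map_lt_map_iff_of_injective H.subtype_injective).2 h1
    rw [e K hK] at h2
    refine h.2 h2 ?_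
    have := (map_lt_map_iff_of_injective H.subtype_injective).2 h3
    rwa [← MonoidHom.range_eq_map, range_subtype] at this
  · intro h
    have := CovBy.map_of_injective H.subtype_injective h
    rwa [e K hK, ← MonoidHom.range_eq_map, range_subtype] at this

theorem mem_map_subtype_frattini {H : Subgroup G} {x : G} :
    x ∈ (frattini H).map H.subtype ↔ x ∈ H ∧ ∀ K, K ⋖ H → x ∈ K := by
  constructor
  · rintro ⟨y, hy, rfl⟩
    refine ⟨y.2, fun K hK => ?_⟩
    exact mem_subgroupOf.1 (frattini_le_coatom ((covBy_iff_isCoatom_subgroupOf hK.le).1 hK) hy)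
  · rintro ⟨hx, h⟩
    refine ⟨⟨x, hx⟩, ?_, rfl⟩
    simp only [frattini, Order.radical, SetLike.mem_coe, mem_iInf]
    intro A hA
    have hA' : (A.map H.subtype).subgroupOf H = A := by
      simp [subgroupOf, comap_map_eq_self_of_injective H.subtype_injective]
    have := h (A.map H.subtype) 
      ((covBy_iff_isCoatom_subgroupOf (map_subtype_le A)).2 (by rw [hA']; exact hA))
    rw [← hA']
    exact this

/-- Elements of `Φ(H)` are non-generators: a maximal subgroup of `H` above a proper `A` would also
contain `N`. -/
theorem eq_of_le_sup_frattini [Finite G] {H A N : Subgroup G} (hA : A ≤ H)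
    (hN : N ≤ (frattini H).map H.subtype) (h : H ≤ A ⊔ N) : A = H := by
  by_contra hne
  obtain ⟨K, h1, h2⟩ := exists_le_covBy_of_lt (lt_of_le_of_ne hA hne)
  exact h2.1.not_ge (h.trans (sup_le h1 fun x hx => (mem_map_subtype_frattini.1 (hN hx)).2 K h2))

theorem eq_bot_of_le_frattini [Finite G] {H : Subgroup G}
    (h : H ≤ (frattini H).map H.subtype) : H = ⊥ :=
  (eq_of_le_sup_frattini bot_le h le_sup_right).symm

/-- Enlarging the ambient group only enlarges the commutator, while `Φ(H)` depends on `H` alone. -/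
theorem IsICPhi.of_map_injective {f : G →* G'} (hf : Function.Injective f) {H : Subgroup G}
    (h : IsICPhi (H.map f)) : IsICPhi H := by
  rintro x ⟨hx, hx'⟩
  refine mem_map_subtype_frattini.2 ⟨hx, fun K hK => ?_⟩
  have h1 : f x ∈ ⁅H.map f, (⊤ : Subgroup G')⁆ := by
    have := mem_map_of_mem f hx'
    rw [map_commutator] at this
    exact commutator_mono le_rfl le_top this
  have := (mem_map_subtype_frattini.1 (h ⟨mem_map_of_mem f hx, h1⟩)).2 _
    (CovBy.map_of_injective hf hK)
  exact (mem_map_iff_mem hf).1 this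

theorem IsICPhi.of_comap_surjective {f : G →* G'} (hf : Function.Surjective f) {H : Subgroup G'}
    (h : IsICPhi (H.comap f)) : IsICPhi H := by
  rintro x ⟨hx, hx'⟩
  have e : ⁅H, (⊤ : Subgroup G')⁆ = (⁅H.comap f, (⊤ : Subgroup G)⁆).map f := by
    rw [map_commutator, map_comap_eq_self_of_surjective hf, map_top_of_surjective f hf]
  rw [e] at hx'
  obtain ⟨y, hy, rfl⟩ := hx'
  refine mem_map_subtype_frattini.2 ⟨hx, fun K hK => ?_⟩
  exact (mem_map_subtype_frattini.1 (h ⟨hx, hy⟩)).2 _ (CovBy.comap_of_surjective hf hK)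

theorem IsICPhi.eq_bot_of_le_commutator [Finite G] {H : Subgroup G} (h : IsICPhi H)
    (hH : H ≤ ⁅H, (⊤ : Subgroup G)⁆) : H = ⊥ :=
  eq_bot_of_le_frattini ((le_inf le_rfl hH).trans h)

instance commutator_top_right_normal (H : Subgroup G) : (⁅H, (⊤ : Subgroup G)⁆).Normal := by
  rw [← normalizer_eq_top_iff, eq_top_iff]
  exact normalizer_commutator_ge_right _ _

theorem normal_of_commutator_top_le {H : Subgroup G} (h : ⁅H, (⊤ : Subgroup G)⁆ ≤ H) : H.Normal :=
  commutator_top_right_le_iff.1 h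

end Frattini

/-! ### Chain lengths measured by the number of prime factors of the order. -/

section Card

open ArithmeticFunction

variable {G : Type*} [Group G]

theorem card_mul_relIndex' {H K : Subgroup G} (h : H ≤ K) :
    Nat.card H * H.relIndex K = Nat.card K := by
  rw [← relIndex_bot_left, ← relIndex_bot_left, relIndex_mul_relIndex _ _ _ bot_le h]

theorem cardFactors_card_lt [Finite G] {H K : Subgroup G} (h : H < K) :
    cardFactors (Nat.card H) < cardFactors (Nat.card K) := by
  have h1 := card_mul_relIndex' h.le
  have h2 : H.relIndex K ≠ 0 := by
    intro h0
    rw [h0, mul_zero] at h1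
    exact Nat.card_pos.ne h1
  have h3 : 1 < H.relIndex K := by
    have : H.relIndex K ≠ 1 := fun h1 => h.not_ge (relIndex_eq_one.1 h1)
    omega
  rw [← h1, cardFactors_mul Nat.card_pos.ne' h2]
  have := cardFactors_pos_iff_one_lt.2 h3
  omega

theorem IsNMaximal.le_cardFactors [Finite G] {n : ℕ} {H : Subgroup G} (h : IsNMaximal n H) :
    cardFactors (Nat.card H) + n ≤ cardFactors (Nat.card G) := by
  induction n generalizing H with
  | zero =>
    rw [isNMaximal_zero] at h
    subst h
    simp
  | succ n ih =>
    obtain ⟨K, hK, h⟩ := isNMaximal_succ.1 h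
    have := cardFactors_card_lt hK.1
    have := ih h
    omega

/-- Groups in which `⊥` is a maximal subgroup have prime order. -/
theorem prime_card_of_isCoatom_bot [Finite G] (h : IsCoatom (⊥ : Subgroup G)) :
    (Nat.card G).Prime := by
  have : Nontrivial G := by
    by_contra hn
    rw [not_nontrivial_iff_subsingleton] at hn
    exact h.1 (Subsingleton.elim _ _)
  obtain ⟨p, hp, hpd⟩ := Nat.exists_prime_and_dvd (Finite.one_lt_card (α := G)).ne'
  have := Fact.mk hp
  obtain ⟨x, hx⟩ := exists_prime_orderOf_dvd_card' p hpd
  have : zpowers x = ⊤ := h.2 _ (bot_lt_iff_ne_bot.2 (by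
    rw [Ne, zpowers_eq_bot]
    rintro rfl
    rw [orderOf_one] at hx
    exact hp.one_lt.ne hx))
  rw [← card_top (G := G), ← this, Nat.card_zpowers, hx]
  exact hp

theorem IsCoatom.prime_index [Finite G] {M : Subgroup G} [M.Normal] (h : IsCoatom M) :
    M.index.Prime := by
  rw [index_eq_card]
  refine prime_card_of_isCoatom_bot ⟨fun e => h.1 ?_, fun A hA => ?_⟩
  · have := congrArg (Subgroup.comap (QuotientGroup.mk' M)) e
    rw [MonoidHom.comap_bot, QuotientGroup.ker_mk', comap_top] at this
    exact this
  · have := (comap_lt_comap_of_surjective (QuotientGroup.mk'_surjective M)).2 hA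
    rw [MonoidHom.comap_bot, QuotientGroup.ker_mk'] at this
    have := h.2 _ this
    rw [← map_comap_eq_self_of_surjective (QuotientGroup.mk'_surjective M) A, this,
      map_top_of_surjective _ (QuotientGroup.mk'_surjective M)]

theorem isCoatom_of_prime_index {M : Subgroup G} (h : M.index.Prime) : IsCoatom M := by
  refine ⟨fun e => h.ne_one (by rw [e, index_top]), fun A hA => ?_⟩
  have h1 := relIndex_mul_index hA.le
  rcases h.eq_one_or_self_of_dvd _ ⟨_, (mul_comm _ _).trans h1 |>.symm⟩ with h2 | h2
  · exact index_eq_one.1 h2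
  · rw [h2] at h1
    have : M.relIndex A = 1 := by
      have := h.pos
      nlinarith
    exact absurd (relIndex_eq_one.1 this) hA.not_ge

theorem IsCoatom.normal_of_isNilpotent [Finite G] [Group.IsNilpotent G] {M : Subgroup G}
    (h : IsCoatom M) : M.Normal := by
  have key := (Group.isNilpotent_of_finite_tfae (G := G)).out 0 2
  exact key.1 ‹_› M h

theorem IsCoatom.prime_index_of_isNilpotent [Finite G] [Group.IsNilpotent G] {M : Subgroup G}
    (h : IsCoatom M) : M.index.Prime :=
  have := h.normal_of_isNilpotent
  h.prime_index

theorem IsNMaximal.cardFactors_eq_of_isNilpotent [Finite G] [Group.IsNilpotent G] {n : ℕ}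
    {H : Subgroup G} (h : IsNMaximal n H) :
    cardFactors (Nat.card H) + n = cardFactors (Nat.card G) := by
  induction n generalizing H with
  | zero =>
    rw [isNMaximal_zero] at h
    subst h
    simp
  | succ n ih =>
    obtain ⟨K, hK, h⟩ := isNMaximal_succ.1 h
    have h1 := ih h
    have h2 := (covBy_iff_isCoatom_subgroupOf hK.le).1 hK
    have h3 : (H.relIndex K).Prime := h2.prime_index_of_isNilpotent
    have h4 := card_mul_relIndex' hK.le
    rw [← h4, cardFactors_mul Nat.card_pos.ne' h3.ne_zero, cardFactors_apply_prime h3] at h1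
    omega

end Card

/-! ### Nilpotency criteria and normal subgroups of prime index. -/

section Nilpotency

variable {G : Type*} [Group G]

theorem commutator_top_le_iff {H N : Subgroup G} [N.Normal] :
    ⁅H, (⊤ : Subgroup G)⁆ ≤ N ↔ H ≤ (center (G ⧸ N)).comap (QuotientGroup.mk' N) := by
  rw [← map_le_iff_le_comap, ← commutator_top_right_eq_bot_iff_le_center,
    ← map_top_of_surjective _ (QuotientGroup.mk'_surjective N), ← map_commutator,
    Subgroup.map_eq_bot_iff, QuotientGroup.ker_mk']

/-- The nontrivial half of Dedekind's modular law; normality makes the join a product set. -/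
theorem inf_sup_le_of_normal {N L M : Subgroup G} [N.Normal] (h : N ≤ L) :
    L ⊓ (N ⊔ M) ≤ N ⊔ (M ⊓ L) := by
  rintro x ⟨hx, hx'⟩
  obtain ⟨n, hn, m, hm, rfl⟩ := mem_sup_of_normal_left.1 hx'
  exact mul_mem_sup hn ⟨hm, (L.mul_mem_cancel_left (h hn)).1 hx⟩

theorem normal_of_commutator_le {M : Subgroup G} (h : commutator G ≤ M) : M.Normal :=
  normal_of_commutator_top_le ((commutator_mono le_top le_rfl).trans h)

theorem commutator_le_of_isCyclic_quotient {L N : Subgroup G} [L.Normal] [N.Normal]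
    [IsCyclic (G ⧸ L)] (hN : N ≤ L) (h : ⁅L, (⊤ : Subgroup G)⁆ ≤ N) : commutator G ≤ N := by
  rw [commutator_def, commutator_top_le_iff]
  have h1 := commutator_top_le_iff.1 h
  let f : G ⧸ N →* G ⧸ L := QuotientGroup.map N L (MonoidHom.id G) hN
  have hf : f.ker ≤ center (G ⧸ N) := by
    intro x hx
    obtain ⟨y, rfl⟩ := QuotientGroup.mk'_surjective N x
    exact h1 ((QuotientGroup.eq_one_iff y).1 hx)
  intro x _
  exact mem_center_iff.2 fun y =>
    (f.isMulCommutative_of_isCyclic_of_ker_le_center hf).is_comm.comm _ _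

theorem isCyclic_quotient_of_prime_index {L : Subgroup G} [L.Normal] (h : L.index.Prime) :
    IsCyclic (G ⧸ L) := by
  have := Fact.mk h
  exact isCyclic_of_prime_card (p := L.index) (index_eq_card L).symm

theorem isNilpotent_of_forall_isCoatom_normal [Finite G]
    (h : ∀ M : Subgroup G, IsCoatom M → M.Normal) : Group.IsNilpotent G := by
  have key := (Group.isNilpotent_of_finite_tfae (G := G)).out 0 2
  exact key.2 h

/-- Here `G/L` is cyclic, so `G' ≤ [L, G] ≤ Φ(L)`. A maximal `M` missing `[L, G]` would give `L = (M
∩ L)[L, G]`, hence `L ≤ M`. So every maximal subgroup contains `G'` and is normal. -/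
theorem IsICPhi.isNilpotent_of_normal_isCoatom [Finite G] {L : Subgroup G} [L.Normal]
    (hL : IsCoatom L) (h : IsICPhi L) : Group.IsNilpotent G := by
  have := isCyclic_quotient_of_prime_index hL.prime_index
  have hle : ⁅L, (⊤ : Subgroup G)⁆ ≤ L := commutator_le_left _ _
  have hN : ⁅L, (⊤ : Subgroup G)⁆ ≤ (frattini L).map L.subtype := (le_inf hle le_rfl).trans h
  have hc := commutator_le_of_isCyclic_quotient hle le_rfl
  refine isNilpotent_of_forall_isCoatom_normal fun M hM => normal_of_commutator_le (hc.trans ?_)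
  by_contra hNM
  have h1 : ⁅L, (⊤ : Subgroup G)⁆ ⊔ M = ⊤ := hM.2 _ (right_lt_sup.2 hNM)
  have h2 := inf_sup_le_of_normal (M := M) hle
  rw [h1, inf_top_eq, sup_comm] at h2
  have h3 := eq_of_le_sup_frattini inf_le_right hN h2
  exact hNM (hle.trans (inf_eq_right.1 h3))

/-- A finite group all of whose maximal subgroups are `ICΦ` is nilpotent. -/
theorem isNilpotent_of_forall_isCoatom_isICPhi [Finite G]
    (h : ∀ M : Subgroup G, IsCoatom M → IsICPhi M) : Group.IsNilpotent G := by
  by_contra hG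
  refine hG (isNilpotent_of_forall_isCoatom_normal fun M hM => ?_)
  by_contra hMn
  have hM0 : M ≠ ⊥ := by
    rintro rfl
    exact hMn inferInstance
  set N := ⁅M, (⊤ : Subgroup G)⁆ with hN
  have hNM : ¬ N ≤ M := fun h' => hMn (normal_of_commutator_top_le h')
  have hNt : N ≠ ⊤ := fun h' => hM0 ((h M hM).eq_bot_of_le_commutator (by rw [← hN, h']; exact le_top))
  have h1 : N ⊔ M = ⊤ := hM.2 _ (right_lt_sup.2 hNM)
  -- Modulo `N` the group is generated by the central image of `M`, so `G/N` is abelian and a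
  -- maximal subgroup above `N` is normal.
  have hc : commutator G ≤ N := by
    rw [commutator_def, commutator_top_le_iff, ← h1, sup_le_iff, ← commutator_top_le_iff,
      ← commutator_top_le_iff]
    exact ⟨commutator_le_left _ _, le_rfl⟩
  obtain ⟨L, hL, hNL⟩ := (eq_top_or_exists_le_coatom N).resolve_left hNt
  have := normal_of_commutator_le (hc.trans hNL)
  exact hG ((h L hL).isNilpotent_of_normal_isCoatom hL)

theorem exists_normal_isSimpleGroup_quotient [Finite G] {N : Subgroup G} [N.Normal] (hN : N ≠ ⊤) :
    ∃ (A : Subgroup G) (_ : A.Normal), N ≤ A ∧ IsSimpleGroup (G ⧸ A) := by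
  obtain ⟨A, hNA, hA⟩ := (Set.toFinite {A : Subgroup G | A.Normal ∧ A ≠ ⊤}).exists_le_maximal
    (show N ∈ {A : Subgroup G | A.Normal ∧ A ≠ ⊤} from ⟨‹_›, hN⟩)
  have hAn : A.Normal := hA.1.1
  refine ⟨A, hAn, hNA, ?_⟩
  have hs := QuotientGroup.mk'_surjective A
  have : Nontrivial (G ⧸ A) := QuotientGroup.nontrivial_iff.2 hA.1.2
  refine ⟨fun B hB => ?_⟩
  by_cases hBt : B.comap (QuotientGroup.mk' A) = ⊤
  · right
    rw [← map_comap_eq_self_of_surjective hs B, hBt, map_top_of_surjective _ hs]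
  · left
    have h1 := hA.2 ⟨hB.comap _, hBt⟩ (by
      conv_lhs => rw [← QuotientGroup.ker_mk' A]
      exact MonoidHom.ker_le_comap _ _)
    rw [← map_comap_eq_self_of_surjective hs B, Subgroup.map_eq_bot_iff, QuotientGroup.ker_mk']
    exact h1

/-- A non-trivial central cyclic subgroup lies in no trivial 2-maximal subgroup, so it is maximal or
the whole group, and the quotient by it is cyclic. -/
theorem isMulCommutative_of_forall_isNMaximal_two_eq_bot [Finite G] [Group.IsNilpotent G]
    (h : ∀ S : Subgroup G, IsNMaximal 2 S → S = ⊥) : IsMulCommutative G := by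
  rcases subsingleton_or_nontrivial G with _ | _
  · exact ⟨⟨fun a b => Subsingleton.elim _ _⟩⟩
  obtain ⟨⟨z, hz⟩, hz1⟩ :=
    ne_bot_iff_exists_ne_one.1 (Group.IsNilpotent.center_ne_bot (G := G))
  replace hz1 : z ≠ 1 := fun h => hz1 (Subtype.ext h)
  have hzc : zpowers z ≤ center G := by rwa [zpowers_le]
  rcases exists_isNMaximal_ge 2 (zpowers z) with ⟨k, hk, hk'⟩ | ⟨S, hS, hS2⟩
  · obtain rfl | rfl : k = 0 ∨ k = 1 := by omega
    · rw [isNMaximal_zero] at hk'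
      rw [hk', top_le_iff] at hzc
      exact ⟨⟨fun a b => (mem_center_iff.1 (hzc ▸ mem_top b : b ∈ center G) a)⟩⟩
    · rw [isNMaximal_one, covBy_top_iff] at hk'
      have := hk'.normal_of_isNilpotent
      have := isCyclic_quotient_of_prime_index hk'.prime_index
      exact (QuotientGroup.mk' (zpowers z)).isMulCommutative_of_isCyclic_of_ker_le_center
        (by rwa [QuotientGroup.ker_mk'])
  · rw [h S hS2, le_bot_iff, zpowers_eq_bot] at hS
    exact absurd hS hz1

/-- For a non-trivial `k`-maximal `H`, simplicity makes `[H, G]` trivial or everything: the latter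
contradicts ICΦ, the former makes `H` central. If no such `H` exists, maximal subgroups are abelian
and Burnside's transfer theorem applies. -/
theorem IsSimpleGroup.prime_card_of_isNMaximal [Finite G] [IsSimpleGroup G]
    (hmax : ∀ M : Subgroup G, IsCoatom M → Group.IsNilpotent M) {k : ℕ} (hk : k = 2 ∨ k = 3)
    (h : ∀ H : Subgroup G, IsNMaximal k H → IsICPhi H) : (Nat.card G).Prime := by
  by_cases hH : ∃ H : Subgroup G, IsNMaximal k H ∧ H ≠ ⊥
  · obtain ⟨H, hH, hH0⟩ := hH
    have hIC := h H hH
    rcases (commutator_top_right_normal H).eq_bot_or_eq_top with h1 | h1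
    · rw [commutator_top_right_eq_bot_iff_le_center] at h1
      rcases (inferInstance : (center G).Normal).eq_bot_or_eq_top with h2 | h2
      · exact absurd (le_bot_iff.1 (h2 ▸ h1)) hH0
      · have : IsMulCommutative G :=
          ⟨⟨fun a b => (mem_center_iff.1 (h2 ▸ mem_top b : b ∈ center G) a)⟩⟩
        exact Group.is_simple_iff_prime_card.1 ‹_›
    · exact absurd (hIC.eq_bot_of_le_commutator (by rw [h1]; exact le_top)) hH0
  · push Not at hH
    have hcomm : ∀ M : Subgroup G, IsCoatom M → IsMulCommutative M := by
      intro M hM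
      have := hmax M hM
      have hM1 : IsNMaximal 1 M := by rwa [isNMaximal_one, covBy_top_iff]
      refine isMulCommutative_of_forall_isNMaximal_two_eq_bot fun S hS => ?_
      rcases hk with rfl | rfl
      · obtain ⟨K, hK, hK1⟩ := isNMaximal_succ.1 hS
        have := hH _ (hM1.map_subtype hK1)
        rw [map_eq_bot_iff_of_injective _ M.subtype_injective] at this
        subst this
        exact absurd hK.1 not_lt_bot
      · have := hH _ (hM1.map_subtype hS)
        rwa [map_eq_bot_iff_of_injective _ M.subtype_injective] at this
    obtain ⟨p, hp, hpd⟩ := Nat.exists_prime_and_dvd (Finite.one_lt_card (α := G)).ne'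
    have := Fact.mk hp
    let P : Sylow p G := default
    have hP0 : (P : Subgroup G) ≠ ⊥ := P.ne_bot_of_dvd_card hpd
    rcases eq_or_ne (P : Subgroup G) ⊤ with hPt | hPt
    · have hG : IsPGroup p G := (P.isPGroup'.of_equiv (MulEquiv.subgroupCongr hPt)).of_equiv topEquiv
      have := hG.isNilpotent
      exact IsSimpleGroup.prime_card
    · have hPn : ¬ (P : Subgroup G).Normal := fun h' => h'.eq_bot_or_eq_top.elim hP0 hPt
      rw [← normalizer_eq_top_iff] at hPn
      obtain ⟨M, hM, hNM⟩ := (eq_top_or_exists_le_coatom _).resolve_left hPn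
      have hMc := hcomm M hM
      -- The normalizer of `P` lies in an abelian maximal subgroup, so it centralizes `P`, and `P`
      -- has a normal complement.
      have hle : normalizer ((P : Subgroup G) : Set G) ≤ centralizer ((P : Subgroup G) : Set G) := by
        intro x hx
        rw [mem_centralizer_iff]
        intro y hy
        have := hMc.is_comm.comm (⟨y, hNM (le_normalizer hy)⟩ : M) ⟨x, hNM hx⟩
        exact congrArg Subtype.val this
      have hc := MonoidHom.ker_transferSylow_isComplement' P hle
      rcases (MonoidHom.normal_ker (MonoidHom.transferSylow P hle)).eq_bot_or_eq_top with h1 | h1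
      · rw [h1, isComplement'_bot_left] at hc
        exact absurd hc hPt
      · rw [h1, isComplement'_top_left] at hc
        exact absurd hc hP0

theorem exists_normal_prime_index [Finite G] [Nontrivial G]
    (hmax : ∀ M : Subgroup G, IsCoatom M → Group.IsNilpotent M) {k : ℕ} (hk : k = 2 ∨ k = 3)
    (h : ∀ H : Subgroup G, IsNMaximal k H → IsICPhi H) :
    ∃ L : Subgroup G, L.Normal ∧ L.index.Prime := by
  obtain ⟨A, hA, -, hs⟩ := exists_normal_isSimpleGroup_quotient (bot_ne_top (α := Subgroup G))
  refine ⟨A, hA, ?_⟩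
  have hsur := QuotientGroup.mk'_surjective A
  rw [index_eq_card]
  refine IsSimpleGroup.prime_card_of_isNMaximal (fun M hM => ?_) hk fun H hH =>
    (h _ (hH.comap_of_surjective hsur)).of_comap_surjective hsur
  have := hmax _ (isCoatom_comap_of_surjective hsur hM)
  exact Group.nilpotent_of_surjective _ (MonoidHom.subgroupComap_surjective_of_surjective _ M hsur)

end Nilpotency

/-! ### Minimal non-nilpotent groups. -/

section Schmidt

variable {G : Type*} [Group G]

theorem isNilpotent_of_le {H K : Subgroup G} (h : H ≤ K) [Group.IsNilpotent K] :
    Group.IsNilpotent H :=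
  Group.nilpotent_of_mulEquiv (subgroupOfEquivOfLe h)

theorem Sylow.le_normalizer_of_isNilpotent [Finite G] {p : ℕ} [Fact p.Prime] (P : Sylow p G)
    {N : Subgroup G} [Group.IsNilpotent N] (h : P ≤ N) :
    N ≤ normalizer ((P : Subgroup G) : Set G) := by
  rw [← normal_subgroupOf_iff_le_normalizer h]
  exact (inferInstance : (P.subtype h : Subgroup N).Normal)

theorem Sylow.normal_of_le_isNilpotent [Finite G] {p : ℕ} [Fact p.Prime] (P : Sylow p G)
    {N : Subgroup G} [N.Normal] [Group.IsNilpotent N] (h : P ≤ N) : (P : Subgroup G).Normal := by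
  have h1 : normalizer ((P : Subgroup G) : Set G) ⊔ N = ⊤ := P.normalizer_sup_eq_top' h
  rwa [sup_eq_left.2 (P.le_normalizer_of_isNilpotent h), normalizer_eq_top_iff] at h1

theorem IsPGroup.le_of_prime_index [Finite G] {p : ℕ} [Fact p.Prime] {P L : Subgroup G} [L.Normal]
    (hP : IsPGroup p P) (hL : L.index.Prime) (hne : p ≠ L.index) : P ≤ L := by
  rw [← relIndex_eq_one]
  obtain ⟨n, hn⟩ := IsPGroup.iff_card.1 hP
  refine Nat.eq_one_of_dvd_coprimes (a := p ^ n) (b := L.index) ?_ ?_ ?_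
  · exact Nat.Coprime.pow_left _ ((Nat.coprime_primes Fact.out hL).2 hne)
  · rw [← hn]
    exact relIndex_dvd_card L P
  · exact relIndex_dvd_index_of_normal L P

theorem sup_commutator_top_normal (H : Subgroup G) : (H ⊔ ⁅H, (⊤ : Subgroup G)⁆).Normal := by
  refine normal_of_commutator_top_le (le_trans ?_ (le_sup_right (a := H)))
  rw [commutator_top_le_iff, sup_le_iff, ← commutator_top_le_iff, ← commutator_top_le_iff]
  exact ⟨le_rfl, commutator_le_left _ _⟩

theorem IsPGroup.exists_orderOf_eq_pow_of_mem {p : ℕ} (hp : p.Prime) {P : Subgroup G} (hP : IsPGroup p P)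
    {x : G} (hx : x ∈ P) : ∃ m, orderOf x = p ^ m := by
  have := Fact.mk hp
  obtain ⟨m, hm⟩ := IsPGroup.iff_orderOf.1 hP ⟨x, hx⟩
  exact ⟨m, by rwa [orderOf_mk] at hm⟩

theorem IsPGroup.eq_one_of_mem_zpowers_pow {p : ℕ} (hp : p.Prime) {P : Subgroup G}
    (hP : IsPGroup p P) {x : G} (hx : x ∈ P) (h : x ∈ zpowers (x ^ p)) : x = 1 := by
  obtain ⟨m, hm⟩ := hP.exists_orderOf_eq_pow_of_mem hp hx
  rw [mem_zpowers_pow_iff, hm] at h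
  rcases m.eq_zero_or_pos with rfl | hm0
  · exact orderOf_eq_one_iff.1 hm
  · exact absurd (h ▸ Nat.dvd_gcd dvd_rfl (dvd_pow_self p hm0.ne')) hp.not_dvd_one

/-- The structure of minimal non-nilpotent groups: a normal Sylow `p`-subgroup `P` with a
`q`-subgroup `Q` as a complement, acting so that every smaller `G`-invariant subgroup is central. -/
structure IsSchmidtPair (p q : ℕ) (P Q : Subgroup G) : Prop where
  normal : P.Normal
  isPGroup_left : IsPGroup p P
  isPGroup_right : IsPGroup q Q
  ne : p ≠ q
  sup_eq_top : P ⊔ Q = ⊤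
  inf_eq_bot : P ⊓ Q = ⊥
  ne_bot : P ≠ ⊥
  eq_top_of_normal : ∀ N : Subgroup G, N.Normal → Q ≤ N → N = ⊤
  le_center_of_normal : ∀ A : Subgroup G, A.Normal → A < P → A ≤ center G

/-- Sylow subgroups for primes other than `q` lie in the nilpotent normal `L`, hence are normal, so
`Q` is not. A proper subgroup containing `Q` lies in a nilpotent maximal subgroup, so it normalizes
`Q`; thus `P`, chosen outside the normalizer, satisfies `PQ = G`. A normal `A < P` normalizes `Q`,
so `[Q, A] ≤ P ∩ Q = 1`, and the normal centralizer of `A` contains `Q`. -/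
theorem exists_isSchmidtPair [Finite G] (hG : ¬ Group.IsNilpotent G)
    (hmax : ∀ M : Subgroup G, IsCoatom M → Group.IsNilpotent M) {L : Subgroup G} [L.Normal]
    (hL : L.index.Prime) :
    ∃ (p q : ℕ) (P Q : Subgroup G), p.Prime ∧ q.Prime ∧ IsSchmidtPair p q P Q := by
  set q := L.index with hq
  have := Fact.mk hL
  have hLnil := hmax L (isCoatom_of_prime_index hL)
  let Q : Sylow q G := default
  have hnorm : ∀ p : ℕ, p.Prime → p ≠ q → ∀ P : Sylow p G, (P : Subgroup G).Normal := by
    intro p hp hpq P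
    have := Fact.mk hp
    exact P.normal_of_le_isNilpotent (P.isPGroup'.le_of_prime_index hL hpq)
  have hQn : normalizer ((Q : Subgroup G) : Set G) ≠ ⊤ := by
    intro hQ
    rw [normalizer_eq_top_iff] at hQ
    have key := (Group.isNilpotent_of_finite_tfae (G := G)).out 0 3
    refine hG (key.2 fun p hp P => ?_)
    by_cases hpq : p = q
    · subst hpq
      have := Sylow.unique_of_normal Q hQ
      rwa [Subsingleton.elim P Q]
    · exact hnorm p hp.out hpq P
  obtain ⟨p, hp, hpd⟩ := Nat.exists_prime_and_dvd (fun h => hQn (index_eq_one.1 h))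
  have hpq : p ≠ q := by
    rintro rfl
    exact Q.not_dvd_index (hpd.trans (index_dvd_of_le le_normalizer))
  have := Fact.mk hp
  let P : Sylow p G := default
  have hPN : ¬ (P : Subgroup G) ≤ normalizer ((Q : Subgroup G) : Set G) := fun h =>
    P.not_dvd_index (hpd.trans (index_dvd_of_le h))
  have hPn := hnorm p hp hpq P
  have hdis : (P : Subgroup G) ⊓ Q = ⊥ :=
    (IsPGroup.disjoint_of_ne p q hpq _ _ P.isPGroup' Q.isPGroup').eq_bot
  have hcoat : ∀ M : Subgroup G, M ≠ ⊤ → (Q : Subgroup G) ≤ M →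
      M ≤ normalizer ((Q : Subgroup G) : Set G) := by
    intro M hM hQM
    obtain ⟨M', hM', hle⟩ := (eq_top_or_exists_le_coatom M).resolve_left hM
    have := hmax M' hM'
    exact hle.trans (Q.le_normalizer_of_isNilpotent (hQM.trans hle))
  have htop : ∀ N : Subgroup G, N.Normal → (Q : Subgroup G) ≤ N → N = ⊤ := by
    intro N hN hQN
    by_contra hNt
    have h1 : normalizer ((Q : Subgroup G) : Set G) ⊔ N = ⊤ := Q.normalizer_sup_eq_top' hQN
    rw [sup_eq_left.2 (hcoat N hNt hQN)] at h1
    exact hQn h1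
  refine ⟨p, q, P, Q, hp, hL, hPn, P.isPGroup', Q.isPGroup', hpq, ?_, hdis, ?_, htop, ?_⟩
  · by_contra h
    exact hPN (le_sup_left.trans (hcoat _ h le_sup_right))
  · intro h
    exact hPN (h ▸ bot_le)
  · intro A hA hAP
    have hAQ : A ⊔ Q ≠ ⊤ := by
      intro h
      have h1 := inf_sup_le_of_normal (M := (Q : Subgroup G)) hAP.le
      rw [h, inf_top_eq, inf_comm, hdis, sup_bot_eq] at h1
      exact hAP.not_ge h1
    have h1 : A ≤ normalizer ((Q : Subgroup G) : Set G) :=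
      le_sup_left.trans (hcoat _ hAQ le_sup_right)
    have h2 : ⁅(Q : Subgroup G), A⁆ = ⊥ := by
      rw [← le_bot_iff, ← hdis, le_inf_iff]
      exact ⟨(commutator_le_right _ _).trans hAP.le, le_normalizer_iff_commutator_le_left.1 h1⟩
    rw [commutator_eq_bot_iff_le_centralizer] at h2
    have h3 := htop _ inferInstance h2
    rw [← centralizer_univ, ← coe_top, ← h3]
    exact le_centralizer_iff.1 le_rfl

namespace IsSchmidtPair

variable {p q : ℕ} {P Q : Subgroup G}

/-- Both `P` and `Q` normalize `[P, G]Q`, so it is all of `G`; now intersect with `P`. -/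
theorem commutator_eq (h : IsSchmidtPair p q P Q) : ⁅P, (⊤ : Subgroup G)⁆ = P := by
  have := h.normal
  have hle : ⁅P, (⊤ : Subgroup G)⁆ ≤ P := commutator_le_left _ _
  have hn : (⁅P, (⊤ : Subgroup G)⁆ ⊔ Q).Normal := by
    rw [← normalizer_eq_top_iff, ← top_le_iff]
    refine h.sup_eq_top.ge.trans (sup_le_iff.2 ?_)
    refine ⟨?_, le_trans (le_sup_right (a := ⁅P, (⊤ : Subgroup G)⁆)) le_normalizer⟩
    rw [le_normalizer_iff_commutator_le_right]
    exact (commutator_mono le_rfl le_top).trans le_sup_left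
  have h1 := inf_sup_le_of_normal (M := Q) hle
  rw [h.eq_top_of_normal _ hn le_sup_right, inf_top_eq, inf_comm, h.inf_eq_bot, sup_bot_eq] at h1
  exact le_antisymm hle h1

theorem not_le_center (h : IsSchmidtPair p q P Q) : ¬ P ≤ center G := by
  rw [← commutator_top_right_eq_bot_iff_le_center, h.commutator_eq]
  exact h.ne_bot

theorem ne_top (h : IsSchmidtPair p q P Q) : P ≠ ⊤ := by
  intro hP
  have h1 := h.inf_eq_bot
  rw [hP, top_inf_eq] at h1
  have h2 := h.eq_top_of_normal ⊥ inferInstance h1.le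
  exact h.ne_bot (le_bot_iff.1 (h2 ▸ le_top))

theorem index_dvd_card (h : IsSchmidtPair p q P Q) : P.index ∣ Nat.card Q := by
  have := h.normal
  rw [← relIndex_top_right, ← h.sup_eq_top, relIndex_sup_left]
  exact relIndex_dvd_card P Q

/-- Otherwise `P = [P, G] ≤ Φ(S)`; as `S = P(Q ∩ S)`, this gives `S ≤ Q` and `P ≤ P ∩ Q = 1`. -/
theorem not_isICPhi_of_le [Finite G] (h : IsSchmidtPair p q P Q) {S : Subgroup G} (hS : P ≤ S) :
    ¬ IsICPhi S := by
  intro hIC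
  have := h.normal
  have h1 : P ≤ (frattini S).map S.subtype := by
    refine (le_inf hS ?_).trans hIC
    conv_lhs => rw [← h.commutator_eq]
    exact commutator_mono hS le_rfl
  have h2 := inf_sup_le_of_normal (M := Q) hS
  rw [h.sup_eq_top, inf_top_eq, sup_comm] at h2
  have h3 := inf_eq_right.1 (eq_of_le_sup_frattini inf_le_right h1 h2)
  exact h.ne_bot (le_bot_iff.1 (h.inf_eq_bot ▸ le_inf le_rfl (hS.trans h3)))

/-- The normal subgroup `F = E[E, G]` is central if `F < P`. If `F = P`, then `P = [F, G] ≤ [E, G]`,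
so `E ≤ [E, G]`, contrary to ICΦ unless `E = 1`. -/
theorem le_center_of_isICPhi [Finite G] (h : IsSchmidtPair p q P Q) {E : Subgroup G} (hE : E ≤ P)
    (hIC : IsICPhi E) : E ≤ center G := by
  have := h.normal
  by_cases h0 : E = ⊥
  · exact h0 ▸ bot_le
  have hle : ⁅E, (⊤ : Subgroup G)⁆ ≤ P := (commutator_mono hE le_rfl).trans h.commutator_eq.le
  have hne : ⁅E, (⊤ : Subgroup G)⁆ ≠ P := fun h' => h0 (hIC.eq_bot_of_le_commutator (h' ▸ hE))
  have hFn := sup_commutator_top_normal E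
  rcases (sup_le hE hle).eq_or_lt with h1 | h1
  · refine absurd (le_antisymm hle ?_) hne
    conv_lhs => rw [← h.commutator_eq]
    rw [← h1, commutator_top_le_iff, sup_le_iff, ← commutator_top_le_iff, ← commutator_top_le_iff]
    exact ⟨le_rfl, commutator_le_left _ _⟩
  · exact le_sup_left.trans (h.le_center_of_normal _ hFn h1)

/-- For abelian `P`, `[x, g]ᵖ` is `xᵖ` times a conjugate of `x⁻ᵖ`, which cancels as `xᵖ` is central.
So the generators of `[P, G] = P` have exponent `p`. -/
theorem pow_eq_one (h : IsSchmidtPair p q P Q) (hcomm : ∀ a ∈ P, ∀ b ∈ P, a * b = b * a)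
    (hpow : ∀ a ∈ P, a ^ p ∈ center G) {a : G} (ha : a ∈ P) : a ^ p = 1 := by
  let T : Subgroup G :=
    { carrier := {x | x ∈ P ∧ x ^ p = 1}
      one_mem' := ⟨P.one_mem, one_pow _⟩
      mul_mem' := fun {x y} hx hy => ⟨P.mul_mem hx.1 hy.1, by
        rw [(show Commute x y from hcomm x hx.1 y hy.1).mul_pow, hx.2, hy.2, one_mul]⟩
      inv_mem' := fun {x} hx => ⟨P.inv_mem hx.1, by rw [inv_pow, hx.2, inv_one]⟩ }
  have key : ⁅P, (⊤ : Subgroup G)⁆ ≤ T := by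
    rw [commutator_le]
    intro x hx g _
    have h1 : g * x⁻¹ * g⁻¹ ∈ P := h.normal.conj_mem _ (P.inv_mem hx) g
    have h2 : ⁅x, g⁆ = x * (g * x⁻¹ * g⁻¹) := by rw [commutatorElement_def]; group
    have h3 : (x * (g * x⁻¹ * g⁻¹)) ^ p = 1 := by
      rw [(show Commute x _ from hcomm x hx _ h1).mul_pow, conj_pow, inv_pow,
        mem_center_iff.1 (inv_mem (hpow x hx)) g]
      group
    rw [h2]
    exact ⟨P.mul_mem hx h1, h3⟩
  rw [h.commutator_eq] at key
  exact (key ha).2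

/-- A non-central element lies in no proper subgroup of `P`, so it generates `P`; then `pow_eq_one`
applies. -/
theorem card_eq_of_forall_covBy_le_center [Finite G] (h : IsSchmidtPair p q P Q) (hp : p.Prime)
    (hc : ∀ E, E ⋖ P → E ≤ center G) : Nat.card P = p := by
  have := Fact.mk hp
  have hmem : ∀ A : Subgroup G, A < P → A ≤ center G := fun A hA => by
    obtain ⟨E, h1, h2⟩ := exists_le_covBy_of_lt hA
    exact h1.trans (hc E h2)
  obtain ⟨a, ha, hac⟩ := SetLike.not_le_iff_exists.1 h.not_le_center
  have haP : zpowers a = P := by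
    by_contra hne
    exact hac (hmem _ (lt_of_le_of_ne (zpowers_le.2 ha) hne) (mem_zpowers a))
  have hcomm : ∀ x ∈ P, ∀ y ∈ P, x * y = y * x := by
    rw [← haP]
    rintro _ ⟨m, rfl⟩ _ ⟨n, rfl⟩
    exact zpow_mul_comm a m n
  have hpow : ∀ x ∈ P, x ^ p ∈ center G := by
    intro x hx
    by_cases hxP : zpowers (x ^ p) = P
    · rw [h.isPGroup_left.eq_one_of_mem_zpowers_pow hp hx (hxP ▸ hx), one_pow]
      exact one_mem _
    · exact hmem _ (lt_of_le_of_ne (zpowers_le.2 (pow_mem hx p)) hxP) (mem_zpowers _)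
  have h1 := h.pow_eq_one hcomm hpow ha
  rw [← haP, Nat.card_zpowers]
  refine orderOf_eq_prime h1 ?_
  rintro rfl
  exact hac (one_mem _)

theorem index_eq_of_isCoatom [Finite G] (h : IsSchmidtPair p q P Q) (hq : q.Prime)
    (hP : IsCoatom P) : P.index = q := by
  have := h.normal
  have := Fact.mk hq
  obtain ⟨n, hn⟩ := IsPGroup.iff_card.1 h.isPGroup_right
  have h1 := h.index_dvd_card
  rw [hn] at h1
  exact (Nat.prime_dvd_prime_iff_eq hP.prime_index hq).1 (hP.prime_index.dvd_of_dvd_pow h1)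

end IsSchmidtPair

/-- A non-nilpotent finite group with nilpotent maximal subgroups in which all second maximal
subgroups are `ICΦ` has order `p * q`. -/
theorem card_eq_mul_of_isNMaximal_two [Finite G] (hG : ¬ Group.IsNilpotent G)
    (hmax : ∀ M : Subgroup G, IsCoatom M → Group.IsNilpotent M)
    (h : ∀ H : Subgroup G, IsNMaximal 2 H → IsICPhi H) :
    ∃ p q : ℕ, p.Prime ∧ q.Prime ∧ p ≠ q ∧ Nat.card G = p * q := by
  have : Nontrivial G := by
    by_contra hn
    rw [not_nontrivial_iff_subsingleton] at hn
    exact hG inferInstance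
  obtain ⟨L, hLn, hL⟩ := exists_normal_prime_index hmax (Or.inl rfl) h
  obtain ⟨p, q, P, Q, hp, hq, hPQ⟩ := exists_isSchmidtPair hG hmax hL
  refine ⟨p, q, hp, hq, hPQ.ne, ?_⟩
  -- No 2-maximal subgroup contains `P`, so `P` is maximal.
  rcases exists_isNMaximal_ge 2 P with ⟨k, hk, hk'⟩ | ⟨S, hS, hS2⟩
  · obtain rfl | rfl : k = 0 ∨ k = 1 := by omega
    · exact absurd (isNMaximal_zero.1 hk') hPQ.ne_top
    · have h1 := covBy_top_iff.1 (isNMaximal_one.1 hk')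
      rw [← P.card_mul_index, hPQ.index_eq_of_isCoatom hq h1,
        hPQ.card_eq_of_forall_covBy_le_center hp fun E hE =>
          hPQ.le_center_of_isICPhi hE.le (h E (isNMaximal_succ.2 ⟨P, hE, hk'⟩))]
  · exact absurd (h S hS2) (hPQ.not_isICPhi_of_le hS)

end Schmidt

/-! ### Nilpotency of the maximal subgroups. -/

section MaximalSubgroups

open ArithmeticFunction

variable {G : Type*} [Group G]

theorem isNilpotent_of_isNMaximal [Finite G] {n : ℕ}
    (h : ∀ H : Subgroup G, IsNMaximal (n + 1) H → IsICPhi H) {K : Subgroup G}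
    (hK : IsNMaximal n K) : Group.IsNilpotent K :=
  isNilpotent_of_forall_isCoatom_isICPhi fun _ hE =>
    (h _ (hK.map_subtype (isNMaximal_one.2 (covBy_top_iff.2 hE)))).of_map_injective
      K.subtype_injective

theorem card_eq_mul_of_isCoatom [Finite G] (h : ∀ H : Subgroup G, IsNMaximal 3 H → IsICPhi H)
    {M : Subgroup G} (hM : IsCoatom M) (hnil : ¬ Group.IsNilpotent M) :
    ∃ p q : ℕ, p.Prime ∧ q.Prime ∧ p ≠ q ∧ Nat.card M = p * q := by
  have hM1 : IsNMaximal 1 M := isNMaximal_one.2 (covBy_top_iff.2 hM)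
  have h2 : ∀ H : Subgroup M, IsNMaximal 2 H → IsICPhi H := fun H hH =>
    (h _ (hM1.map_subtype hH)).of_map_injective M.subtype_injective
  exact card_eq_mul_of_isNMaximal_two hnil (fun K hK =>
    isNilpotent_of_isNMaximal h2 (isNMaximal_one.2 (covBy_top_iff.2 hK))) h2

theorem cardFactors_card_pos [Finite G] {H : Subgroup G} :
    0 < cardFactors (Nat.card H) ↔ H ≠ ⊥ := by
  rw [cardFactors_pos_iff_one_lt, one_lt_card_iff_ne_bot]

theorem eq_bot_or_eq_of_prime_card [Finite G] {A H : Subgroup G} (hH : (Nat.card H).Prime)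
    (h : A ≤ H) : A = ⊥ ∨ A = H := by
  rcases h.eq_or_lt with h1 | h1
  · exact Or.inr h1
  · left
    by_contra h2
    have h3 := cardFactors_card_lt h1
    rw [cardFactors_apply_prime hH] at h3
    have := cardFactors_card_pos.2 h2
    omega

theorem IsCoatom.normal_of_commutator_le {M H : Subgroup G} (hM : IsCoatom M) (hH : ¬ H ≤ M)
    (h : ⁅H, (⊤ : Subgroup G)⁆ ≤ M) : M.Normal := by
  have h1 : H ≤ normalizer (M : Set G) :=
    le_normalizer_iff_commutator_le_right.2 ((commutator_mono le_rfl le_top).trans h)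
  rw [← normalizer_eq_top_iff]
  exact hM.2 _ (lt_of_le_of_ne le_normalizer fun e => hH (h1.trans e.ge))

/-- If all third maximal subgroups are `ICΦ` and one of them is nontrivial, then all maximal
subgroups are nilpotent. -/
theorem isNilpotent_of_isCoatom_of_isNMaximal_three [Finite G]
    (hnontriv : ∃ H : Subgroup G, IsNMaximal 3 H ∧ H ≠ ⊥)
    (hIC : ∀ H : Subgroup G, IsNMaximal 3 H → IsICPhi H) {M : Subgroup G} (hM : IsCoatom M) :
    Group.IsNilpotent M := by
  by_contra hnil
  obtain ⟨H, hH, hH0⟩ := hnontriv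
  have hG : 4 ≤ cardFactors (Nat.card G) := by
    have h1 := hH.le_cardFactors
    have h2 := cardFactors_card_pos.2 hH0
    omega
  have hcoat : ∀ A : Subgroup G, IsCoatom A → ¬ Group.IsNilpotent A →
      cardFactors (Nat.card A) = 2 := by
    intro A hA hAn
    obtain ⟨p, q, hp, hq, -, h1⟩ := card_eq_mul_of_isCoatom hIC hA hAn
    rw [h1, cardFactors_mul hp.ne_zero hq.ne_zero, cardFactors_apply_prime hp,
      cardFactors_apply_prime hq]
  have hsucc : ∀ A : Subgroup G, A.index.Prime →
      cardFactors (Nat.card G) = cardFactors (Nat.card A) + 1 := by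
    intro A hA
    rw [← A.card_mul_index, cardFactors_mul Nat.card_pos.ne' hA.ne_zero,
      cardFactors_apply_prime hA]
  have hM2 := hcoat M hM hnil
  have hMn : ¬ M.Normal := by
    intro hMn
    have := hsucc M hM.prime_index
    omega
  have hprime : ∀ A : Subgroup G, A ≤ M → A ≠ M → A ≠ ⊥ → (Nat.card A).Prime := by
    intro A h1 h2 h3
    rw [← cardFactors_eq_one_iff_prime]
    have := cardFactors_card_lt (lt_of_le_of_ne h1 h2)
    have := cardFactors_card_pos.2 h3
    omega
  -- A central subgroup of prime order would have prime index in `M`, making `M` abelian.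
  have hcent : ∀ A : Subgroup G, A ≤ M → (Nat.card A).Prime → ⁅A, M⁆ ≠ ⊥ := by
    intro A hA hAp h0
    rw [commutator_eq_bot_iff_le_centralizer] at h0
    have h1 : A.subgroupOf M ≤ center M := fun x hx => mem_center_iff.2 fun y =>
      Subtype.ext (h0 (mem_subgroupOf.1 hx) y y.2)
    have : (A.subgroupOf M).Normal := ⟨fun x hx y => by
      rwa [mem_center_iff.1 (h1 hx) y, mul_inv_cancel_right]⟩
    have h2 : (A.subgroupOf M).index.Prime := by
      have h3 := card_mul_relIndex' hA
      have h4 : A.relIndex M ≠ 0 := fun h4 => by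
        rw [h4, mul_zero] at h3
        exact Nat.card_pos.ne h3
      rw [← h3, cardFactors_mul Nat.card_pos.ne' h4, cardFactors_apply_prime hAp] at hM2
      exact cardFactors_eq_one_iff_prime.1 (show cardFactors (A.relIndex M) = 1 by omega)
    have := isCyclic_quotient_of_prime_index h2
    have hc := (QuotientGroup.mk' (A.subgroupOf M)).isMulCommutative_of_isCyclic_of_ker_le_center
      (by rwa [QuotientGroup.ker_mk'])
    refine hnil (isNilpotent_of_forall_isCoatom_normal fun B _ => ⟨fun x hx y => ?_⟩)
    rwa [hc.is_comm.comm y x, mul_inv_cancel_right]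
  -- If `H ≤ M`, the normal subgroup `H[H, G]` is proper in `M`, so it has prime order and equals
  -- `H`. Then `[H, G]` is `1`, against `hcent`, or `H`, against ICΦ.
  have hNM : ¬ ⁅H, (⊤ : Subgroup G)⁆ ≤ M := by
    intro hNM
    by_cases hHM : H ≤ M
    · have hFn := sup_commutator_top_normal H
      have hF0 : H ⊔ ⁅H, (⊤ : Subgroup G)⁆ ≠ ⊥ := fun h => hH0 (le_bot_iff.1 (h ▸ le_sup_left))
      have hFp := hprime _ (sup_le hHM hNM) (fun e => hMn (e ▸ hFn)) hF0
      have hHF := (eq_bot_or_eq_of_prime_card hFp le_sup_left).resolve_left hH0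
      have hNH : ⁅H, (⊤ : Subgroup G)⁆ ≤ H := by
        conv_rhs => rw [hHF]
        exact le_sup_right
      rw [← hHF] at hFp
      rcases eq_bot_or_eq_of_prime_card hFp hNH with h1 | h1
      · exact hcent H hHM hFp (le_bot_iff.1 (h1 ▸ commutator_mono le_rfl le_top))
      · exact hH0 ((hIC H hH).eq_bot_of_le_commutator h1.ge)
    · exact hMn (hM.normal_of_commutator_le hHM hNM)
  obtain ⟨L, hLn, hL⟩ : ∃ L : Subgroup G, L.Normal ∧ L.index.Prime := by
    have hNt : ⁅H, (⊤ : Subgroup G)⁆ ≠ ⊤ := fun h =>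
      hH0 ((hIC H hH).eq_bot_of_le_commutator (by rw [h]; exact le_top))
    obtain ⟨A, hA, hNA, hs⟩ := exists_normal_isSimpleGroup_quotient hNt
    refine ⟨A, hA, ?_⟩
    have hAM : A ⊔ M = ⊤ := hM.2 _ (right_lt_sup.2 fun h => hNM (hNA.trans h))
    obtain ⟨p, q, hp, hq, hpq, hcard⟩ := card_eq_mul_of_isCoatom hIC hM hnil
    -- Squarefree order makes `M` soluble; it maps onto the simple group `G/A`, which therefore has
    -- prime order.
    have : IsZGroup M := by
      refine IsZGroup.of_squarefree ?_
      rw [hcard, Nat.squarefree_mul ((Nat.coprime_primes hp hq).2 hpq)]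
      exact ⟨hp.squarefree, hq.squarefree⟩
    have hsur : Function.Surjective ((QuotientGroup.mk' A).comp M.subtype) := by
      rw [← MonoidHom.range_eq_top, MonoidHom.range_comp, range_subtype, ← top_le_iff,
        ← map_top_of_surjective _ (QuotientGroup.mk'_surjective A), ← hAM, Subgroup.map_sup]
      refine sup_le ?_ le_rfl
      rw [(Subgroup.map_eq_bot_iff A).2 (QuotientGroup.ker_mk' A).ge]
      exact bot_le
    have hsol : Group.IsSolvable (G ⧸ A) := Group.isSolvable_of_surjective hsur
    have hc := IsSimpleGroup.comm_iff_isSolvable.2 hsol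
    have : IsMulCommutative (G ⧸ A) := ⟨⟨hc⟩⟩
    rw [index_eq_card]
    exact Group.is_simple_iff_prime_card.1 hs
  have hLc := isCoatom_of_prime_index hL
  have hL3 := hsucc L hL
  have hLnil : Group.IsNilpotent L := by
    by_contra h
    have := hcoat L hLc h
    omega
  have hML : ¬ M ≤ L := fun h => hnil (isNilpotent_of_le h)
  have hD : (Nat.card (M ⊓ L : Subgroup G)).Prime := by
    refine hprime _ inf_le_left (fun h => hML (inf_eq_left.1 h)) fun h => ?_
    have h1 : L.relIndex M = L.index := by
      rw [← relIndex_top_right, ← hLc.2 _ (left_lt_sup.2 hML), relIndex_sup_left]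
    have h2 := card_mul_relIndex' (inf_le_left : M ⊓ L ≤ M)
    rw [inf_relIndex_left, h1, h, card_bot, one_mul] at h2
    rw [← h2, cardFactors_apply_prime hL] at hM2
    omega
  set D := M ⊓ L with hDdef
  have hD0 : D ≠ ⊥ := fun h => by
    rw [h, card_bot] at hD
    exact Nat.not_prime_one hD
  -- `L` is nilpotent with at least three prime factors and `D` has one, so a maximal chain of `L`
  -- takes two steps without dropping below `D`.
  obtain ⟨E, hE3, hDE, hEL⟩ : ∃ E : Subgroup G, IsNMaximal 3 E ∧ D ≤ E ∧ E ≤ L := by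
    rcases exists_isNMaximal_ge 2 (D.subgroupOf L) with ⟨k, hk, hk'⟩ | ⟨S, hS, hS2⟩
    · have h1 := hk'.cardFactors_eq_of_isNilpotent
      rw [Nat.card_congr (subgroupOfEquivOfLe (inf_le_right : D ≤ L)).toEquiv,
        cardFactors_apply_prime hD] at h1
      omega
    · refine ⟨S.map L.subtype,
        (isNMaximal_one.2 (covBy_top_iff.2 hLc)).map_subtype hS2, ?_, map_subtype_le S⟩
      have h1 := map_mono (f := L.subtype) hS
      rwa [subgroupOf_map_subtype, inf_eq_left.2 (inf_le_right : D ≤ L)] at h1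
  have hE0 : E ≠ ⊥ := fun h => hD0 (le_bot_iff.1 (h ▸ hDE))
  have hER : ¬ E ≤ ⁅E, (⊤ : Subgroup G)⁆ := fun h => hE0 ((hIC E hE3).eq_bot_of_le_commutator h)
  have hRL : ⁅E, (⊤ : Subgroup G)⁆ ≤ L := (commutator_mono hEL le_rfl).trans (commutator_le_left _ _)
  have hDR : D ≤ ⁅E, (⊤ : Subgroup G)⁆ := by
    have h1 : ⁅D, M⁆ ≤ D := le_inf
      ((commutator_mono inf_le_left le_rfl).trans M.commutator_le_self)
      ((commutator_mono inf_le_right le_rfl).trans (commutator_le_left _ _))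
    have h2 := (eq_bot_or_eq_of_prime_card hD h1).resolve_left (hcent D inf_le_left hD)
    rw [← h2]
    exact commutator_mono hDE le_top
  -- With `R = [E, G]`: if `R ≤ M`, then `E ≤ M ∩ L = D ≤ R` or `M` is normal; otherwise `RM = G`
  -- and `L = RD = R ≥ E`. Each case is impossible.
  by_cases hRM : ⁅E, (⊤ : Subgroup G)⁆ ≤ M
  · by_cases hEM : E ≤ M
    · exact hER ((le_inf hEM hEL).trans hDR)
    · exact hMn (hM.normal_of_commutator_le hEM hRM)
  · have h1 := inf_sup_le_of_normal (M := M) hRL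
    rw [hM.2 _ (right_lt_sup.2 hRM), inf_top_eq, ← hDdef, sup_eq_left.2 hDR] at h1
    exact hER (hEL.trans h1)

end MaximalSubgroups

/-! ### Recognising `SL₂(3)` by generators and relations. -/

section SpecialLinear

/-- Generators and relations of the semidirect product of a quaternion group of order `8`, generated
by `a` and `b`, with a group of order `3`, generated by `y`. -/
structure IsQuaternionTriple {G : Type*} [Group G] (a b y : G) : Prop where
  pow_four : a ^ 4 = 1
  sq_eq : b ^ 2 = a ^ 2
  comm : b * a = a ^ 3 * b
  pow_three : y ^ 3 = 1
  conj_left : y * a = b * y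
  conj_right : y * b = a * b * y

namespace IsQuaternionTriple

variable {G : Type*} [Group G] {a b y : G}

theorem pow_mul_pow (h : IsQuaternionTriple a b y) (j k : ℕ) :
    b ^ j * a ^ k = a ^ (3 ^ j * k) * b ^ j := by
  have h1 : ∀ k : ℕ, b * a ^ k = a ^ (3 * k) * b := fun k => by
    have : SemiconjBy b a (a ^ 3) := h.comm
    rw [pow_mul]
    exact this.pow_right k
  induction j generalizing k with
  | zero => simp
  | succ j ih => rw [pow_succ, mul_assoc, h1, ← mul_assoc, ih, mul_assoc, ← pow_succ, pow_succ 3,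
      mul_assoc]

theorem exists_pow_mul_pow_eq_mul (h : IsQuaternionTriple a b y) (i j k l : ℕ) :
    ∃ m n : ℕ, a ^ i * b ^ j * (a ^ k * b ^ l) = a ^ m * b ^ n := by
  refine ⟨i + 3 ^ j * k, j + l, ?_⟩
  rw [mul_assoc, ← mul_assoc (b ^ j), h.pow_mul_pow, pow_add, pow_add]
  group

theorem exists_mul_pow_eq (h : IsQuaternionTriple a b y) (j : ℕ) :
    ∃ m n : ℕ, (a * b) ^ j = a ^ m * b ^ n := by
  induction j with
  | zero => exact ⟨0, 0, by simp⟩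
  | succ j ih =>
    obtain ⟨m, n, ih⟩ := ih
    rw [pow_succ, ih]
    simpa using h.exists_pow_mul_pow_eq_mul m n 1 1

/-- The elements `a ^ i * b ^ j * y ^ k`. -/
def words (a b y : G) : Set G := {x | ∃ i j k : ℕ, x = a ^ i * b ^ j * y ^ k}

theorem mul_mem_words (h : IsQuaternionTriple a b y) {s : G} (hs : s ∈ ({a, b, y} : Set G)) {x : G}
    (hx : x ∈ words a b y) : s * x ∈ words a b y := by
  obtain ⟨i, j, k, rfl⟩ := hx
  rcases hs with rfl | rfl | rfl
  · exact ⟨i + 1, j, k, by rw [pow_succ']; group⟩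
  · obtain ⟨m, n, hmn⟩ := h.exists_pow_mul_pow_eq_mul 0 1 i j
    refine ⟨m, n, k, ?_⟩
    rw [← hmn]
    group
  · have h1 : s * a ^ i = b ^ i * s := (show SemiconjBy s a b from h.conj_left).pow_right i
    have h2 : s * b ^ j = (a * b) ^ j * s := (show SemiconjBy s b (a * b) from h.conj_right).pow_right j
    obtain ⟨m, n, hmn⟩ := h.exists_mul_pow_eq j
    obtain ⟨m', n', hmn'⟩ := h.exists_pow_mul_pow_eq_mul 0 i m n
    refine ⟨m', n', k + 1, ?_⟩
    rw [← hmn', ← hmn, mul_assoc (a ^ i), ← mul_assoc s, h1, mul_assoc, ← mul_assoc s (b ^ j), h2,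
      pow_succ' s]
    group

theorem pow_mul_mem_words (h : IsQuaternionTriple a b y) {s : G} (hs : s ∈ ({a, b, y} : Set G))
    (n : ℕ) {x : G} (hx : x ∈ words a b y) : s ^ n * x ∈ words a b y := by
  induction n with
  | zero => simpa using hx
  | succ n ih =>
    rw [pow_succ', mul_assoc]
    exact h.mul_mem_words hs ih

/-- A common exponent of the generators, used to replace inverses by eleventh powers. -/
theorem pow_twelve (h : IsQuaternionTriple a b y) {s : G} (hs : s ∈ ({a, b, y} : Set G)) :
    s ^ 12 = 1 := by
  rcases hs with rfl | rfl | rfl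
  · rw [show 12 = 4 * 3 from rfl, pow_mul, h.pow_four, one_pow]
  · rw [show 12 = 2 * 6 from rfl, pow_mul, h.sq_eq, ← pow_mul, show 2 * 6 = 4 * 3 from rfl, pow_mul,
      h.pow_four, one_pow]
  · rw [show 12 = 3 * 4 from rfl, pow_mul, h.pow_three, one_pow]

theorem closure_subset_words (h : IsQuaternionTriple a b y) :
    (closure {a, b, y} : Set G) ⊆ words a b y := by
  intro x hx
  induction hx using closure_induction_left with
  | one => exact ⟨0, 0, 0, by simp⟩
  | mul_left s hs x _ ih => exact h.mul_mem_words hs ih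
  | inv_mul_cancel s hs x _ ih =>
    have h1 : s⁻¹ = s ^ 11 := by
      rw [inv_eq_iff_mul_eq_one, ← pow_succ', h.pow_twelve hs]
    rw [h1]
    exact h.pow_mul_mem_words hs 11 ih

theorem words_subset_range (h : IsQuaternionTriple a b y) :
    words a b y ⊆ Set.range fun e : Fin 4 × Fin 2 × Fin 3 =>
      a ^ (e.1 : ℕ) * b ^ (e.2.1 : ℕ) * y ^ (e.2.2 : ℕ) := by
  rintro _ ⟨i, j, k, rfl⟩
  refine ⟨(⟨(i + 2 * (j / 2)) % 4, Nat.mod_lt _ (by norm_num)⟩,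
    ⟨j % 2, Nat.mod_lt _ (by norm_num)⟩, ⟨k % 3, Nat.mod_lt _ (by norm_num)⟩), ?_⟩
  have h1 : b ^ j = a ^ (2 * (j / 2)) * b ^ (j % 2) := by
    conv_lhs => rw [← Nat.div_add_mod j 2, pow_add, pow_mul, h.sq_eq, ← pow_mul]
  rw [h1, ← mul_assoc, ← pow_add]
  simp only
  rw [← pow_eq_pow_mod _ h.pow_four, ← pow_eq_pow_mod _ h.pow_three]

theorem card_closure_le (h : IsQuaternionTriple a b y) : Nat.card (closure {a, b, y}) ≤ 24 := by
  have h1 := h.closure_subset_words.trans h.words_subset_range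
  have h2 := Set.ncard_le_ncard h1 (Set.finite_range _)
  have h3 := Set.ncard_image_le (f := fun e : Fin 4 × Fin 2 × Fin 3 =>
      a ^ (e.1 : ℕ) * b ^ (e.2.1 : ℕ) * y ^ (e.2.2 : ℕ)) (Set.finite_univ)
  rw [Set.image_univ, Set.ncard_univ, Nat.card_eq_fintype_card] at h3
  exact h2.trans h3

theorem prodMk {G' : Type*} [Group G'] {a' b' y' : G'} (h : IsQuaternionTriple a b y)
    (h' : IsQuaternionTriple a' b' y') : IsQuaternionTriple (a, a') (b, b') (y, y') :=
  ⟨Prod.ext h.1 h'.1, Prod.ext h.2 h'.2, Prod.ext h.3 h'.3, Prod.ext h.4 h'.4, Prod.ext h.5 h'.5,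
    Prod.ext h.6 h'.6⟩

/-- The closure has at most 24 elements and surjects onto a group of order 24. -/
theorem bijective_of_closure {G' : Type*} [Group G'] {f : G →* G'} (h : IsQuaternionTriple a b y)
    [Finite G] (hgen : closure {f a, f b, f y} = ⊤) (hcard : Nat.card G' = 24) :
    Function.Bijective (f.domRestrict (closure {a, b, y})) := by
  have hs : Function.Surjective (f.domRestrict (closure {a, b, y})) := by
    rw [← MonoidHom.range_eq_top, MonoidHom.domRestrict_range, MonoidHom.map_closure, ← hgen]
    congr 1
    simp [Set.image_insert_eq]
  refine (Nat.bijective_iff_surjective_and_card _).2 ⟨hs, ?_⟩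
  have h1 := Nat.card_le_card_of_surjective _ hs
  have h2 := h.card_closure_le
  omega

/-- The paired generators span a subgroup of `G × G'` that projects bijectively to both factors: the
graph of an isomorphism. -/
theorem nonempty_mulEquiv {G' : Type*} [Group G'] [Finite G] [Finite G'] {a' b' y' : G'}
    (h : IsQuaternionTriple a b y) (h' : IsQuaternionTriple a' b' y')
    (hgen : closure {a, b, y} = ⊤) (hgen' : closure {a', b', y'} = ⊤)
    (hcard : Nat.card G = 24) (hcard' : Nat.card G' = 24) : Nonempty (G ≃* G') :=
  ⟨(MulEquiv.ofBijective _
      ((h.prodMk h').bijective_of_closure (f := MonoidHom.fst G G') hgen hcard)).symm.trans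
    (MulEquiv.ofBijective _
      ((h.prodMk h').bijective_of_closure (f := MonoidHom.snd G G') hgen' hcard'))⟩

end IsQuaternionTriple

open Matrix

/-- Here `a² = -1`, `y` is a transvection and `b = y a y⁻¹`. -/
theorem isQuaternionTriple_specialLinearGroup :
    IsQuaternionTriple (G := SpecialLinearGroup (Fin 2) (ZMod 3))
      ⟨!![0, 2; 1, 0], by decide⟩ ⟨!![1, 1; 1, 2], by decide⟩ ⟨!![1, 1; 0, 1], by decide⟩ := by
  constructor <;> decide +kernel

theorem card_specialLinearGroup_two_three :
    Nat.card (SpecialLinearGroup (Fin 2) (ZMod 3)) = 24 := by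
  rw [Nat.card_eq_fintype_card]
  decide +kernel

theorem closure_specialLinearGroup_two_three :
    Subgroup.closure ({⟨!![0, 2; 1, 0], by decide⟩, ⟨!![1, 1; 1, 2], by decide⟩,
      ⟨!![1, 1; 0, 1], by decide⟩} : Set (SpecialLinearGroup (Fin 2) (ZMod 3))) = ⊤ := by
  set A : SpecialLinearGroup (Fin 2) (ZMod 3) := ⟨!![0, 2; 1, 0], by decide⟩ with hA
  set B : SpecialLinearGroup (Fin 2) (ZMod 3) := ⟨!![1, 1; 1, 2], by decide⟩ with hB
  set Y : SpecialLinearGroup (Fin 2) (ZMod 3) := ⟨!![1, 1; 0, 1], by decide⟩ with hY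
  have key : ∀ M : SpecialLinearGroup (Fin 2) (ZMod 3), ∃ (i : Fin 4) (j : Fin 2) (k : Fin 3),
      M = A ^ (i : ℕ) * B ^ (j : ℕ) * Y ^ (k : ℕ) := by
    decide +kernel
  rw [eq_top_iff]
  intro M _
  obtain ⟨i, j, k, rfl⟩ := key M
  exact mul_mem (mul_mem (pow_mem (subset_closure (by simp)) _)
    (pow_mem (subset_closure (by simp)) _)) (pow_mem (subset_closure (by simp)) _)

theorem IsQuaternionTriple.nonempty_mulEquiv_specialLinearGroup {G : Type*} [Group G] [Finite G]
    {a b y : G} (h : IsQuaternionTriple a b y) (hgen : Subgroup.closure {a, b, y} = ⊤)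
    (hcard : Nat.card G = 24) : Nonempty (G ≃* SpecialLinearGroup (Fin 2) (ZMod 3)) :=
  h.nonempty_mulEquiv isQuaternionTriple_specialLinearGroup hgen
    closure_specialLinearGroup_two_three hcard card_specialLinearGroup_two_three

end SpecialLinear

/-! ### Schmidt pairs in which second maximal subgroups of `P` are central. -/

section PrimeIndex

open ArithmeticFunction

variable {G : Type*} [Group G]

theorem exists_covBy_covBy_of_le [Finite G] {A P : Subgroup G} (h : A ≤ P) :
    A = P ∨ A ⋖ P ∨ ∃ E K, A ≤ E ∧ E ⋖ K ∧ K ⋖ P := by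
  rcases h.eq_or_lt with h1 | h1
  · exact Or.inl h1
  · obtain ⟨K, h2, h3⟩ := exists_le_covBy_of_lt h1
    rcases h2.eq_or_lt with rfl | h4
    · exact Or.inr (Or.inl h3)
    · obtain ⟨E, h5, h6⟩ := exists_le_covBy_of_lt h4
      exact Or.inr (Or.inr ⟨E, K, h5, h6, h3⟩)

theorem IsPGroup.relIndex_eq_of_covBy [Finite G] {p : ℕ} (hp : p.Prime) {A P : Subgroup G}
    (hP : IsPGroup p P) (h : A ⋖ P) : A.relIndex P = p := by
  have := Fact.mk hp
  have := hP.isNilpotent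
  have h1 : (A.relIndex P).Prime :=
    ((covBy_iff_isCoatom_subgroupOf h.le).1 h).prime_index_of_isNilpotent
  obtain ⟨n, hn⟩ := IsPGroup.iff_card.1 hP
  have h2 := relIndex_dvd_card A P
  rw [hn] at h2
  exact (Nat.prime_dvd_prime_iff_eq h1 hp).1 (h1.dvd_of_dvd_pow h2)

theorem IsPGroup.card_eq_mul_of_covBy [Finite G] {p : ℕ} (hp : p.Prime) {A P : Subgroup G}
    (hP : IsPGroup p P) (h : A ⋖ P) : Nat.card P = Nat.card A * p := by
  rw [← hP.relIndex_eq_of_covBy hp h, card_mul_relIndex' h.le]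

theorem IsPGroup.le_normalizer_of_covBy [Finite G] {p : ℕ} (hp : p.Prime) {A P : Subgroup G}
    (hP : IsPGroup p P) (h : A ⋖ P) : P ≤ normalizer (A : Set G) := by
  have := Fact.mk hp
  have := hP.isNilpotent
  rw [← normal_subgroupOf_iff_le_normalizer h.le]
  exact ((covBy_iff_isCoatom_subgroupOf h.le).1 h).normal_of_isNilpotent

/-- The `n`-th power of a product of two elements whose commutator is central. -/
theorem mul_pow_of_commutator {x y t : G} (ht : t ∈ center G) (h : y * x = t * x * y) (n : ℕ) :
    (x * y) ^ n = t ^ n.choose 2 * x ^ n * y ^ n := by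
  have hc : ∀ (k : ℕ) (g : G), g * t ^ k = t ^ k * g := fun k g => mem_center_iff.1 (pow_mem ht k) g
  have h1 : ∀ k : ℕ, y ^ k * x = t ^ k * x * y ^ k := by
    intro k
    induction k with
    | zero => simp
    | succ k ih =>
      rw [pow_succ y, mul_assoc, h, mul_assoc t, ← mul_assoc _ t, ← pow_one t, hc, pow_one, mul_assoc t,
        ← mul_assoc (y ^ k) x, ih, pow_succ']
      simp only [mul_assoc]
  induction n with
  | zero => simp
  | succ n ih =>
    rw [pow_succ (x * y), ih, Nat.choose_succ_succ' n 1, Nat.choose_one_right, pow_add t, pow_succ x,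
      pow_succ y, mul_assoc _ (y ^ n), ← mul_assoc (y ^ n) x, h1, hc (n.choose (1 + 1)) (t ^ n)]
    simp only [mul_assoc]
    rw [← mul_assoc (x ^ n) (t ^ n), hc n (x ^ n)]
    simp only [mul_assoc]

theorem commutator_pow_eq_one {x y t : G} (ht : t ∈ center G) (h : y * x = t * x * y) {n : ℕ}
    (hx : x ^ n ∈ center G) : t ^ n = 1 := by
  have h1 : SemiconjBy y x (t * x) := h
  have h2 : y * x ^ n = (t * x) ^ n * y := h1.pow_right n
  rw [(show Commute t x from (mem_center_iff.1 ht x).symm).mul_pow, mul_assoc,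
    ← mem_center_iff.1 hx y, eq_comm, mul_eq_right] at h2
  exact h2

namespace IsSchmidtPair

variable {p q : ℕ} {P Q : Subgroup G}

/-- If `P` is abelian, its `p`-th powers form a normal subgroup, proper by Cauchy's theorem, hence
central, and `P` has exponent `p`. A non-central `a` of order `p` lies in no second maximal
subgroup, so `|P| ≤ p²`. -/
theorem not_commutative [Finite G] (h : IsSchmidtPair p q P Q) (hp : p.Prime)
    (hcard : 3 ≤ cardFactors (Nat.card P))
    (hE : ∀ E K : Subgroup G, E ⋖ K → K ⋖ P → E ≤ center G) :
    ¬ ∀ a ∈ P, ∀ b ∈ P, a * b = b * a := by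
  intro hcomm
  have := Fact.mk hp
  let T : Subgroup G :=
    { carrier := {x | ∃ u ∈ P, u ^ p = x}
      one_mem' := ⟨1, P.one_mem, one_pow _⟩
      mul_mem' := by
        rintro _ _ ⟨u, hu, rfl⟩ ⟨v, hv, rfl⟩
        exact ⟨u * v, P.mul_mem hu hv, (show Commute u v from hcomm u hu v hv).mul_pow p⟩
      inv_mem' := by
        rintro _ ⟨u, hu, rfl⟩
        exact ⟨u⁻¹, P.inv_mem hu, inv_pow u p⟩ }
  have hTn : T.Normal := ⟨by
    rintro _ ⟨u, hu, rfl⟩ g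
    exact ⟨g * u * g⁻¹, h.normal.conj_mem u hu g, conj_pow⟩⟩
  have hTP : T < P := by
    refine lt_of_le_of_ne (by rintro _ ⟨u, hu, rfl⟩; exact pow_mem hu p) fun hTP => ?_
    have hsur : Function.Surjective fun u : P => u ^ p := by
      rintro ⟨x, hx⟩
      obtain ⟨u, hu, rfl⟩ : x ∈ T := hTP ▸ hx
      exact ⟨⟨u, hu⟩, rfl⟩
    have hinj := Finite.injective_iff_surjective.2 hsur
    have := (nontrivial_iff_ne_bot P).2 h.ne_bot
    obtain ⟨n, hn0, hn⟩ := h.isPGroup_left.nontrivial_iff_card.1 this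
    obtain ⟨x, hx⟩ := exists_prime_orderOf_dvd_card' (G := P) p (hn ▸ dvd_pow_self p hn0.ne')
    have hx1 : x = 1 := hinj (by simp only [one_pow]; rw [← hx, pow_orderOf_eq_one])
    rw [hx1, orderOf_one] at hx
    exact hp.one_lt.ne hx
  have hTc := h.le_center_of_normal T hTn hTP
  obtain ⟨a, ha, hac⟩ := SetLike.not_le_iff_exists.1 h.not_le_center
  have ha1 : orderOf a = p := orderOf_eq_prime
    (h.pow_eq_one hcomm (fun u hu => hTc ⟨u, hu, rfl⟩) ha) (by rintro rfl; exact hac (one_mem _))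
  have hca : cardFactors (Nat.card (zpowers a)) = 1 := by
    rw [Nat.card_zpowers, ha1, cardFactors_apply_prime hp]
  rcases exists_covBy_covBy_of_le (zpowers_le.2 ha) with h1 | h1 | ⟨E, K, h1, h2, h3⟩
  · rw [← h1] at hcard
    omega
  · rw [h.isPGroup_left.card_eq_mul_of_covBy hp h1, cardFactors_mul Nat.card_pos.ne' hp.ne_zero,
      cardFactors_apply_prime hp] at hcard
    omega
  · exact hac (hE E K h2 h3 (h1 (mem_zpowers a)))

section NonCentral

variable [Finite G] (h : IsSchmidtPair p q P Q) (hp : p.Prime)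
  (hcard : 3 ≤ cardFactors (Nat.card P))
  (hE : ∀ E K : Subgroup G, E ⋖ K → K ⋖ P → E ≤ center G) {a : G} (ha : a ∈ P)
  (hac : a ∉ center G)

include h hp hcard hE ha hac

theorem zpowers_covBy : zpowers a ⋖ P := by
  rcases exists_covBy_covBy_of_le (zpowers_le.2 ha) with h1 | h1 | ⟨E, K, h1, h2, h3⟩
  · refine absurd ?_ (h.not_commutative hp hcard hE)
    rw [← h1]
    rintro _ ⟨m, rfl⟩ _ ⟨n, rfl⟩
    exact zpow_mul_comm a m n
  · exact h1
  · exact absurd (hE E K h2 h3 (h1 (mem_zpowers a))) hac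

theorem le_center_of_lt_zpowers {B : Subgroup G} (hB : B < zpowers a) : B ≤ center G := by
  obtain ⟨E, h1, h2⟩ := exists_le_covBy_of_lt hB
  exact h1.trans (hE E _ h2 (h.zpowers_covBy hp hcard hE ha hac))

theorem pow_mem_center : a ^ p ∈ center G := by
  refine h.le_center_of_lt_zpowers hp hcard hE ha hac (lt_of_le_of_ne
    (zpowers_le.2 (pow_mem (mem_zpowers a) p)) fun e => hac ?_) (mem_zpowers (a ^ p))
  rw [h.isPGroup_left.eq_one_of_mem_zpowers_pow hp ha (e ▸ mem_zpowers a)]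
  exact one_mem _

/-- Otherwise the maximal subgroup `⟨a⟩` and `P ∩ Z(G)` generate `P`, which would be abelian. -/
theorem inf_center_le_zpowers : P ⊓ center G ≤ zpowers a := by
  by_contra hle
  have hcov := h.zpowers_covBy hp hcard hE ha hac
  have h1 : zpowers a ⊔ (P ⊓ center G) = P :=
    hcov.eq_or_eq le_sup_left (sup_le hcov.le inf_le_left) |>.resolve_left
      fun e => hle (sup_eq_left.1 e)
  have h2 : P ≤ centralizer {a} := by
    rw [← h1, sup_le_iff, zpowers_le]
    exact ⟨mem_centralizer_singleton_iff.2 rfl, inf_le_right.trans (center_le_centralizer _)⟩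
  have h3 : P ≤ centralizer (P : Set G) := by
    conv_lhs => rw [← h1]
    rw [sup_le_iff, zpowers_le]
    refine ⟨?_, inf_le_right.trans (center_le_centralizer _)⟩
    exact mem_centralizer_iff.2 fun x hx => mem_centralizer_singleton_iff.1 (h2 hx)
  exact h.not_commutative hp hcard hE fun x hx y hy => mem_centralizer_iff.1 (h3 hy) x hx

/-- Otherwise `g` normalizes `⟨a⟩`, as does the maximal subgroup `P`; so `⟨a⟩` is normal in `G` and
therefore central. -/
theorem conj_notMem_zpowers (hP : IsCoatom P) {g : G} (hg : g ∉ P) :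
    g * a * g⁻¹ ∉ zpowers a := by
  intro hmem
  have hcov := h.zpowers_covBy hp hcard hE ha hac
  have h1 : g ∈ normalizer (zpowers a : Set G) := by
    refine mem_normalizer_fintype ?_
    rintro _ ⟨m, rfl⟩
    simp only
    rw [← conj_zpow]
    exact zpow_mem hmem m
  have h2 := h.isPGroup_left.le_normalizer_of_covBy hp hcov
  have h3 : normalizer (zpowers a : Set G) = ⊤ :=
    hP.2 _ (lt_of_le_of_ne h2 fun e => hg (e ▸ h1))
  exact hac (h.le_center_of_normal _ (normalizer_eq_top_iff.1 h3) hcov.1 (mem_zpowers a))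

/-- `⟨a⟩` and `⟨b⟩` are both normal in `P`, so the commutator lies in their intersection, a proper
subgroup of `⟨a⟩`. -/
theorem commutator_mem_center {b : G} (hb : b ∈ P) (hbc : b ∉ center G) (hab : b ∉ zpowers a) :
    b * a * b⁻¹ * a⁻¹ ∈ center G := by
  have hcov := h.zpowers_covBy hp hcard hE ha hac
  have hcov' := h.zpowers_covBy hp hcard hE hb hbc
  have h1 : b * a * b⁻¹ * a⁻¹ ∈ zpowers a := mul_mem
    ((mem_normalizer_iff.1 (h.isPGroup_left.le_normalizer_of_covBy hp hcov hb) a).1 (mem_zpowers a))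
    (inv_mem (mem_zpowers a))
  have h2 : b * a * b⁻¹ * a⁻¹ ∈ zpowers b := by
    rw [mul_assoc, mul_assoc, ← mul_assoc a]
    exact mul_mem (mem_zpowers b) ((mem_normalizer_iff.1
      (h.isPGroup_left.le_normalizer_of_covBy hp hcov' ha) b⁻¹).1 (inv_mem (mem_zpowers b)))
  refine h.le_center_of_lt_zpowers hp hcard hE ha hac (B := zpowers a ⊓ zpowers b)
    (inf_lt_left.2 fun hle => hab ?_) ⟨h1, h2⟩
  have hcards : Nat.card (zpowers a) = Nat.card (zpowers b) := by
    have h3 := h.isPGroup_left.card_eq_mul_of_covBy hp hcov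
    rw [h.isPGroup_left.card_eq_mul_of_covBy hp hcov'] at h3
    exact (Nat.eq_of_mul_eq_mul_right hp.pos h3).symm
  rw [eq_of_le_of_card_ge hle hcards.ge]
  exact mem_zpowers b

end NonCentral

end IsSchmidtPair

end PrimeIndex

/-! ### The quaternion Sylow subgroup and the final identification. -/

section QuaternionSylow

open ArithmeticFunction

variable {G : Type*} [Group G]

theorem conj_notMem_center {a : G} (ha : a ∉ center G) (g : G) : g * a * g⁻¹ ∉ center G :=
  fun h => ha (by simpa [mul_assoc] using normal_of_characteristic (center G) |>.conj_mem _ h g⁻¹)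

theorem conj_eq_of_mem_center {a : G} (ha : a ∈ center G) (g : G) : g * a * g⁻¹ = a := by
  rw [mem_center_iff.1 ha g, mul_inv_cancel_right]

namespace IsSchmidtPair

variable {p q : ℕ} {P Q : Subgroup G} [Finite G]

/-- For a conjugate `b` of `a` outside `⟨a⟩`, `bᵖ = aᵖ`. If `p` is odd, it divides `p.choose 2`, so
the class two formula gives `(a⁻¹b)ᵖ = 1`. This non-central element generates a maximal subgroup of
order `p`, and `|P| = p²`. -/
theorem eq_two (h : IsSchmidtPair p q P Q) (hp : p.Prime) (hP : IsCoatom P)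
    (hcard : 3 ≤ cardFactors (Nat.card P))
    (hE : ∀ E K : Subgroup G, E ⋖ K → K ⋖ P → E ≤ center G) : p = 2 := by
  by_contra hp2
  obtain ⟨a, ha, hac⟩ := SetLike.not_le_iff_exists.1 h.not_le_center
  obtain ⟨g, -, hg⟩ := SetLike.exists_of_lt hP.lt_top
  have hab := h.conj_notMem_zpowers hp hcard hE ha hac hP hg
  have hb : g * a * g⁻¹ ∈ P := h.normal.conj_mem a ha g
  have hbc := conj_notMem_center hac g
  have hbp : (g * a * g⁻¹) ^ p = a ^ p := by
    rw [conj_pow, conj_eq_of_mem_center (h.pow_mem_center hp hcard hE ha hac)]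
  set b := g * a * g⁻¹
  have ha' : a⁻¹ ∈ P := inv_mem ha
  have hac' : a⁻¹ ∉ center G := fun h' => hac (by simpa using inv_mem h')
  have hcc : a⁻¹ * b ∉ center G := by
    intro h1
    have h2 := h.inf_center_le_zpowers hp hcard hE ha hac ⟨mul_mem ha' hb, h1⟩
    exact hab (by simpa using mul_mem (mem_zpowers a) h2)
  have ht := h.commutator_mem_center hp hcard hE ha' hac' hb hbc (by rwa [zpowers_inv])
  have hbt : b * a⁻¹ = (b * a⁻¹ * b⁻¹ * a⁻¹⁻¹) * a⁻¹ * b := by group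
  have htp := commutator_pow_eq_one ht hbt (h.pow_mem_center hp hcard hE ha' hac')
  have hcp : (a⁻¹ * b) ^ p = 1 := by
    obtain ⟨k, hk⟩ := hp.dvd_choose_self two_ne_zero (lt_of_le_of_ne hp.two_le (Ne.symm hp2))
    rw [mul_pow_of_commutator ht hbt, hk, pow_mul, htp, one_pow, one_mul, hbp, inv_pow,
      inv_mul_cancel]
  have hord : orderOf (a⁻¹ * b) = p :=
    have := Fact.mk hp
    orderOf_eq_prime hcp fun h1 => hcc (h1 ▸ one_mem _)
  have hcov := h.zpowers_covBy hp hcard hE (mul_mem ha' hb) hcc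
  rw [h.isPGroup_left.card_eq_mul_of_covBy hp hcov, Nat.card_zpowers, hord,
    cardFactors_mul hp.ne_zero hp.ne_zero, cardFactors_apply_prime hp] at hcard
  omega

/-- When `P` has prime index and its second maximal subgroups are central, `G` is `SL₂(3)`. -/
theorem nonempty_mulEquiv_specialLinearGroup (h : IsSchmidtPair p q P Q) (hp : p.Prime)
    (hq : q.Prime) (hP : IsCoatom P) (hcard : 3 ≤ cardFactors (Nat.card P))
    (hE : ∀ E K : Subgroup G, E ⋖ K → K ⋖ P → E ≤ center G) :
    Nonempty (G ≃* Matrix.SpecialLinearGroup (Fin 2) (ZMod 3)) := by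
  obtain rfl := h.eq_two hp hP hcard hE
  have := h.normal
  have hind := h.index_eq_of_isCoatom hq hP
  have hQcard : Nat.card Q = q := by
    have h1 : P.relIndex Q = P.index := by
      rw [← relIndex_top_right, ← h.sup_eq_top, relIndex_sup_left]
    have h2 := card_mul_relIndex' (inf_le_right : P ⊓ Q ≤ Q)
    rwa [inf_relIndex_right, h1, h.inf_eq_bot, card_bot, one_mul, hind, eq_comm] at h2
  obtain ⟨y, hyQ, hyP⟩ : ∃ y ∈ Q, y ∉ P := by
    refine SetLike.not_le_iff_exists.1 fun h1 => h.ne_top ?_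
    rw [← h.sup_eq_top, sup_eq_left.2 h1]
  have hyq : y ^ q = 1 := by
    have h1 : (⟨y, hyQ⟩ : Q) ^ Nat.card Q = 1 := pow_card_eq_one'
    rw [hQcard] at h1
    simpa using congrArg Subtype.val h1
  have hypow : ∀ n : ℕ, y ^ n ∈ P → q ∣ n := by
    intro n hn
    by_contra hqn
    have hco : Nat.Coprime n q := ((Nat.Prime.coprime_iff_not_dvd hq).2 hqn).symm
    have h1 : y ∈ zpowers (y ^ n) := by
      rw [mem_zpowers_pow_iff]
      exact hco.coprime_dvd_right (orderOf_dvd_of_pow_eq_one hyq)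
    exact hyP ((zpowers_le.2 hn) h1)
  obtain ⟨a, ha, hac⟩ := SetLike.not_le_iff_exists.1 h.not_le_center
  set b := y * a * y⁻¹ with hbdef
  set d := y * b * y⁻¹ with hddef
  have hb : b ∈ P := h.normal.conj_mem a ha y
  have hbc : b ∉ center G := conj_notMem_center hac y
  have hd : d ∈ P := h.normal.conj_mem b hb y
  have hab : b ∉ zpowers a := h.conj_notMem_zpowers hp hcard hE ha hac hP hyP
  have hbd : d ∉ zpowers b := h.conj_notMem_zpowers hp hcard hE hb hbc hP hyP
  have had : d ∉ zpowers a := by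
    have h1 : y ^ 2 ∉ P := fun h1 => h.ne ((Nat.prime_dvd_prime_iff_eq hq hp).1 (hypow 2 h1)).symm
    have h2 := h.conj_notMem_zpowers hp hcard hE ha hac hP h1
    rwa [show y ^ 2 * a * (y ^ 2)⁻¹ = d by rw [hddef, hbdef, pow_two]; group] at h2
  have hz : a ^ 2 ∈ center G := h.pow_mem_center hp hcard hE ha hac
  have hbz : b ^ 2 = a ^ 2 := by rw [hbdef, conj_pow, conj_eq_of_mem_center hz]
  have hdz : d ^ 2 = a ^ 2 := by rw [hddef, conj_pow, hbz, conj_eq_of_mem_center hz]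
  have hcov := h.zpowers_covBy hp hcard hE ha hac
  -- `d` lies in the coset `a * b * Z(G)`
  obtain ⟨k, hk⟩ : ∃ k : ℤ, d = a * b * (a ^ 2) ^ k := by
    -- Neither `d` nor `b` lies in the index two subgroup `⟨a⟩`, so `d b⁻¹ = aᵐ`. Even `m` would put
    -- `d` in `⟨b⟩`, because `a² = b²`.
    have hidx : ((zpowers a).subgroupOf P).index = 2 :=
      h.isPGroup_left.relIndex_eq_of_covBy hp hcov
    have h1 : (⟨d, hd⟩ * ⟨b⁻¹, inv_mem hb⟩ : P) ∈ (zpowers a).subgroupOf P := by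
      rw [mul_mem_iff_of_index_two hidx, mem_subgroupOf, mem_subgroupOf]
      exact iff_of_false had fun h' => hab (by simpa using inv_mem h')
    obtain ⟨m, hm⟩ := mem_subgroupOf.1 h1
    replace hm : a ^ m = d * b⁻¹ := hm
    rw [eq_mul_inv_iff_mul_eq] at hm
    rcases Int.even_or_odd' m with ⟨k, rfl | rfl⟩
    · refine absurd ?_ hbd
      rw [← hm, zpow_mul, zpow_ofNat, ← hbz]
      exact mul_mem (zpow_mem (pow_mem (mem_zpowers b) 2) k) (mem_zpowers b)
    · refine ⟨k, ?_⟩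
      rw [← hm, add_comm, zpow_add, zpow_one, zpow_mul, zpow_ofNat, mul_assoc, mul_assoc,
        mem_center_iff.1 (zpow_mem hz k) b]
  set z := a ^ 2 with hzdef
  have hzk : ∀ k : ℤ, z ^ k ∈ center G := fun k => zpow_mem hz k
  have ht := h.commutator_mem_center hp hcard hE ha hac hb hbc hab
  obtain ⟨t, htdef⟩ : ∃ t, t = b * a * b⁻¹ * a⁻¹ := ⟨_, rfl⟩
  have hba : b * a = t * a * b := by rw [htdef]; group
  rw [← htdef] at ht
  have ht2 : t ^ 2 = 1 := commutator_pow_eq_one ht hba hz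
  have htza : t ∈ zpowers a := by
    refine h.inf_center_le_zpowers hp hcard hE ha hac ⟨?_, ht⟩
    rw [htdef]
    exact P.mul_mem (mul_mem (mul_mem hb ha) (inv_mem hb)) (inv_mem ha)
  -- Conjugation by `y³` sends `a` into `⟨a⟩`, so `y³ ∈ P`.
  have hq3 : q = 3 := by
    have h1 : y ^ 3 ∈ P := by
      by_contra h1
      refine h.conj_notMem_zpowers hp hcard hE ha hac hP h1 ?_
      have h2 : y ^ 3 * a * (y ^ 3)⁻¹ = t * a * z * z ^ k * z ^ k := calc
        y ^ 3 * a * (y ^ 3)⁻¹ = y * d * y⁻¹ := by rw [hddef, hbdef, pow_succ, pow_two]; group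
        _ = (y * a * y⁻¹) * (y * b * y⁻¹) * (y * z ^ k * y⁻¹) := by rw [hk]; group
        _ = b * d * z ^ k := by rw [conj_eq_of_mem_center (hzk k)]
        _ = (b * a) * b * z ^ k * z ^ k := by rw [hk]; group
        _ = t * a * (b ^ 2) * z ^ k * z ^ k := by rw [hba, pow_two]; group
        _ = t * a * z * z ^ k * z ^ k := by rw [hbz]
      have hza : z ∈ zpowers a := pow_mem (mem_zpowers a) 2
      rw [h2]
      exact mul_mem (mul_mem (mul_mem (mul_mem htza (mem_zpowers a)) hza) (zpow_mem hza k))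
        (zpow_mem hza k)
    exact (Nat.prime_dvd_prime_iff_eq hq Nat.prime_three).1 (hypow 3 h1)
  subst hq3
  -- Compare `d² = z` with the square of `a b zᵏ`.
  have htz : t * z ^ (1 + 2 * k) = 1 := by
    have h1 : d ^ 2 = t * z ^ (1 + 2 * k) * z := by
      have h2 : (a * b) ^ 2 = t * z * z := by
        rw [mul_pow_of_commutator ht hba, hbz]
        simp [hzdef]
      rw [hk, (show Commute (a * b) (z ^ k) from mem_center_iff.1 (hzk k) (a * b)).mul_pow, h2]
      group
    rw [hdz] at h1
    exact (mul_eq_right.1 h1.symm)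
  -- The order of `z` is a power of two dividing `2(1 + 2k)`, hence at most two.
  have hz2 : z ^ 2 = 1 := by
    have h1 : z ^ (2 * (1 + 2 * k)) = 1 := by
      have h2 : z ^ (1 + 2 * k) = t⁻¹ := (inv_eq_of_mul_eq_one_right htz).symm
      rw [mul_comm, zpow_mul, h2, zpow_ofNat, inv_pow, ht2, inv_one]
    obtain ⟨m, hm⟩ := h.isPGroup_left.exists_orderOf_eq_pow_of_mem hp (pow_mem ha 2)
    rw [← orderOf_dvd_iff_zpow_eq_one, hzdef, hm] at h1
    rw [← orderOf_dvd_iff_pow_eq_one, hzdef, hm]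
    by_contra h2
    have h3 : 2 ≤ m := by
      by_contra h3
      exact h2 (pow_dvd_pow 2 (show m ≤ 1 by omega))
    have h4 : ((2 ^ 2 : ℕ) : ℤ) ∣ 2 * (1 + 2 * k) :=
      dvd_trans (Int.natCast_dvd_natCast.2 (pow_dvd_pow 2 h3)) h1
    norm_num at h4
    omega
  have hz2k : z ^ (2 * k) = 1 := by rw [zpow_mul, zpow_ofNat, hz2, one_zpow]
  have htz' : t = z := by
    rw [zpow_add, zpow_one, hz2k, mul_one] at htz
    rw [eq_inv_of_mul_eq_one_left htz, inv_eq_iff_mul_eq_one, ← pow_two, hz2]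
  have ha4 : a ^ 4 = 1 := by rw [show 4 = 2 * 2 from rfl, pow_mul, ← hzdef, hz2]
  have hba3 : b * a = a ^ 3 * b := by rw [hba, htz', hzdef, ← pow_succ]
  have hcardG : Nat.card G = 24 := by
    have h1 := h.isPGroup_left.card_eq_mul_of_covBy hp hcov
    rw [Nat.card_zpowers] at h1
    have h2 : orderOf a ∣ 2 ^ 2 := orderOf_dvd_of_pow_eq_one ha4
    obtain ⟨m, hm, h3⟩ := (Nat.dvd_prime_pow hp).1 h2
    rw [h1, h3, ← pow_succ, cardFactors_apply_prime_pow hp] at hcard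
    obtain rfl : m = 2 := by omega
    rw [← P.card_mul_index, hind, h1, h3]
    norm_num
  have hgen : ∀ S : Subgroup G, a ∈ S → b ∈ S → y ∈ S → S = ⊤ := by
    intro S haS hbS hyS
    have h1 : S ⊓ P = P := by
      refine (hcov.eq_or_eq (le_inf (zpowers_le.2 haS) hcov.le) inf_le_right).resolve_left
        fun e => hab ?_
      rw [← e]
      exact ⟨hbS, hb⟩
    exact hP.2 S (lt_of_le_of_ne (inf_eq_right.1 h1) fun e => hyP (e ▸ hyS))
  have hya : y * a = b * y := by rw [hbdef]; group
  have hyb : y * b = d * y := by rw [hddef]; group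
  -- For even `k`, `d = ab` as required. For odd `k`, `d = ba`, and passing to `a⁻¹`, `b⁻¹` restores
  -- the order of the factors.
  rcases Int.even_or_odd' k with ⟨j, hj | hj⟩
  · refine IsQuaternionTriple.nonempty_mulEquiv_specialLinearGroup (a := a) (b := b) (y := y)
      ⟨ha4, hbz, hba3, hyq, hya, ?_⟩
      (hgen _ (subset_closure (by simp)) (subset_closure (by simp)) (subset_closure (by simp))) hcardG
    rw [hyb, hk, hj, zpow_mul, zpow_ofNat, hz2, one_zpow, mul_one]
  · have hdba : d = b * a := by
      rw [hk, hj, zpow_add, zpow_mul, zpow_ofNat, hz2, one_zpow, one_mul, zpow_one,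
        mem_center_iff.1 hz, hba, htz', mul_assoc]
    have hab3 : a * b = b * a ^ 3 := by
      have h1 : SemiconjBy b a (a ^ 3) := hba3
      have h2 : b * a ^ 3 = (a ^ 3) ^ 3 * b := h1.pow_right 3
      rw [h2, ← pow_mul, show 3 * 3 = 4 * 2 + 1 from rfl, pow_succ, pow_mul, ha4, one_pow, one_mul]
    refine IsQuaternionTriple.nonempty_mulEquiv_specialLinearGroup (a := a⁻¹) (b := b⁻¹) (y := y)
      ⟨?_, ?_, ?_, hyq, ?_, ?_⟩ (hgen _ ?_ ?_ (subset_closure (by simp))) hcardG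
    · rw [inv_pow, ha4, inv_one]
    · rw [inv_pow, inv_pow, hbz]
    · rw [inv_pow, ← mul_inv_rev, ← mul_inv_rev, hab3]
    · rw [mul_inv_eq_iff_eq_mul, mul_assoc, hya, inv_mul_cancel_left]
    · rw [mul_inv_eq_iff_eq_mul, ← mul_inv_rev, mul_assoc, hyb, hdba, inv_mul_cancel_left]
    · exact inv_mem_iff.1 (subset_closure (by simp))
    · exact inv_mem_iff.1 (subset_closure (by simp))

end IsSchmidtPair

/-- A non-nilpotent finite group with nilpotent maximal subgroups, in which all third maximal
subgroups are `ICΦ` and one of them is nontrivial, is `SL₂(3)`. -/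
theorem nonempty_mulEquiv_specialLinearGroup_of_isNMaximal_three [Finite G]
    (hG : ¬ Group.IsNilpotent G) (hmax : ∀ M : Subgroup G, IsCoatom M → Group.IsNilpotent M)
    (hnontriv : ∃ H : Subgroup G, IsNMaximal 3 H ∧ H ≠ ⊥)
    (hIC : ∀ H : Subgroup G, IsNMaximal 3 H → IsICPhi H) :
    Nonempty (G ≃* Matrix.SpecialLinearGroup (Fin 2) (ZMod 3)) := by
  have : Nontrivial G := by
    by_contra hn
    rw [not_nontrivial_iff_subsingleton] at hn
    exact hG inferInstance
  have hG4 : 4 ≤ cardFactors (Nat.card G) := by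
    obtain ⟨H, hH, hH0⟩ := hnontriv
    have h1 := hH.le_cardFactors
    have h2 := cardFactors_card_pos.2 hH0
    omega
  obtain ⟨L, hLn, hL⟩ := exists_normal_prime_index hmax (Or.inr rfl) hIC
  obtain ⟨p, q, P, Q, hp, hq, h⟩ := exists_isSchmidtPair hG hmax hL
  have := h.normal
  rcases exists_isNMaximal_ge 3 P with ⟨k, hk, hk'⟩ | ⟨S, hS, hS3⟩
  · obtain rfl | rfl | rfl : k = 0 ∨ k = 1 ∨ k = 2 := by omega
    · exact absurd (isNMaximal_zero.1 hk') h.ne_top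
    · have hP := covBy_top_iff.1 (isNMaximal_one.1 hk')
      refine h.nonempty_mulEquiv_specialLinearGroup hp hq hP ?_ fun E K hEK hKP =>
        h.le_center_of_isICPhi (hEK.le.trans hKP.le)
          (hIC E (isNMaximal_succ.2 ⟨K, hEK, isNMaximal_succ.2 ⟨P, hKP, hk'⟩⟩))
      rw [← P.card_mul_index, cardFactors_mul Nat.card_pos.ne' hP.prime_index.ne_zero,
        cardFactors_apply_prime hP.prime_index] at hG4
      omega
    -- Here `|P| = p`, and the trivial subgroup is 2-maximal in the `q`-group `G/P`, so `|G|` has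
    -- only three prime factors.
    · exfalso
      have hPcard := h.card_eq_of_forall_covBy_le_center hp fun E hE =>
        h.le_center_of_isICPhi hE.le (hIC E (isNMaximal_succ.2 ⟨P, hE, hk'⟩))
      have := Fact.mk hq
      have hGP : Group.IsNilpotent (G ⧸ P) := by
        obtain ⟨n, hn⟩ := IsPGroup.iff_card.1 h.isPGroup_right
        have h1 := h.index_dvd_card
        rw [hn, index_eq_card] at h1
        obtain ⟨m, -, hm⟩ := (Nat.dvd_prime_pow hq).1 h1
        exact (IsPGroup.of_card hm).isNilpotent
      have h2 : IsNMaximal 2 (⊥ : Subgroup (G ⧸ P)) := by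
        have h1 := hk'.map_of_surjective (QuotientGroup.mk'_surjective P) (QuotientGroup.ker_mk' P).le
        rwa [(Subgroup.map_eq_bot_iff P).2 (QuotientGroup.ker_mk' P).ge] at h1
      have h3 := h2.cardFactors_eq_of_isNilpotent
      rw [card_bot, cardFactors_one, ← index_eq_card] at h3
      rw [← P.card_mul_index, hPcard, cardFactors_mul hp.ne_zero index_ne_zero_of_finite,
        cardFactors_apply_prime hp] at hG4
      omega
  · exact absurd (hIC S hS3) (h.not_isICPhi_of_le hS)

end QuaternionSylow

theorem theorem1p9 {G : Type*} [Group G] [Finite G]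
    (hnontriv : ∃ H : Subgroup G, IsNMaximal 3 H ∧ H ≠ ⊥)
    (hIC : ∀ H : Subgroup G, IsNMaximal 3 H → IsICPhi H) :
    Group.IsNilpotent G ∨ Nonempty (G ≃* Matrix.SpecialLinearGroup (Fin 2) (ZMod 3)) := by
  by_cases hG : Group.IsNilpotent G
  · exact Or.inl hG
  · exact Or.inr (nonempty_mulEquiv_specialLinearGroup_of_isNMaximal_three hG
      (fun _ hM => isNilpotent_of_isCoatom_of_isNMaximal_three hnontriv hIC hM) hnontriv hIC)
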